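/- For a finite set $P\subset\mathbb R^2$ and $t\in\mathbb R$ let $\check C_t(P)$ be the Čech complex: the abstract simplicial complex whose simplices are the nonempty subsets $\{x_0,\dots,x_k\}\subseteq P$ for which the closed Euclidean discs in $\mathbb R^2$ of radius $t$ around $x_0,\dots,x_k$ have a common point (for $t<0$ it is empty). Let $\mathbf k$ be a field and let $\mathrm{PH}_1(P)$ be the persistence module $t\mapsto \tilde H_1(\check C_t(P);\mathbf k)$, with the maps induced by the inclusions $\check C_s(P)\subseteq\check C_t(P)$, $s\le t$. A barcode of a persistence module is a finite multiset of nonempty bounded intervals of $\mathbb R$ such that the module is isomorphic to the direct sum of the corresponding interval modules. Let $n\ge 1$ and let $X_1,\dots,X_n$ be independent random variables, uniformly distributed (with respect to arc length) on the unit circle $\mathbb S^1=\{x\in\mathbb R^2 : \|x\|=1\}$, and let $P_n=\{X_1,\dots,X_n\}$. Then $\mathrm{PH}_1(P_n)$ always has a barcode $\beta_1(P_n)$, which is unique and consists of at most one interval. Let $\ell(\beta_1(P_n))$ be the length of this interval, and $0$ if there is none. Then $\ell(\beta_1(P_n))$ is integrable and $$\mathbb E[\ell(\beta_1(P_n))]=1-\sum_{k=1}^{n}(-1)^{k-1}\binom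 nk\int_0^{\min\left(\frac12,\frac1k\right)}\pi\cos(\pi t)\,(1-kt)^{n-1}\,dt .$$ -/

import Mathlib

/-! ## Persistence modules and barcodes -/

/-- A persistence module over the field `𝕜`, indexed by `ℝ`. -/
structure PersistenceModule (𝕜 : Type*) [Field 𝕜] where
  space : ℝ → Type*
  [addCommGroup : ∀ t, AddCommGroup (space t)]
  [module : ∀ t, Module 𝕜 (space t)]
  map : ∀ {s t : ℝ}, s ≤ t → space s →ₗ[𝕜] space t
  map_refl : ∀ t : ℝ, map (le_refl t) = LinearMap.id
  map_trans : ∀ {r s t : ℝ} (hrs : r ≤ s) (hst : s ≤ t),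
    map (hrs.trans hst) = map hst ∘ₗ map hrs

namespace PersistenceModule

attribute [instance] PersistenceModule.addCommGroup PersistenceModule.module

/-- An isomorphism of persistence modules. -/
structure Iso {𝕜 : Type*} [Field 𝕜] (V W : PersistenceModule 𝕜) where
  equiv : ∀ t : ℝ, V.space t ≃ₗ[𝕜] W.space t
  naturality : ∀ {s t : ℝ} (h : s ≤ t) (x : V.space s),
    equiv t (V.map h x) = W.map h (equiv s x)

/-- The direct sum of a family of persistence modules. -/
def directSum {𝕜 : Type*} [Field 𝕜] {ι : Type*} (V : ι → PersistenceModule 𝕜) :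
    PersistenceModule 𝕜 where
  space t := DirectSum ι fun i => (V i).space t
  map h := DirectSum.lmap fun i => (V i).map h
  map_refl t := by simp [map_refl]
  map_trans hrs hst := by
    simp only [fun i => (V i).map_trans hrs hst]
    exact DirectSum.lmap_comp _ _

end PersistenceModule

/-- A bar: a nonempty bounded interval of the real line, of any of the four types
`(p, q)`, `(p, q]`, `[p, q)`, `[p, q]`. -/
@[ext]
structure Bar where
  carrier : Set ℝ
  nonempty : carrier.Nonempty
  ordConnected : carrier.OrdConnected
  isBounded : Bornology.IsBounded carrier

/-- The length of a bar: right endpoint minus left endpoint. -/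
noncomputable def Bar.length (I : Bar) : ℝ := sSup I.carrier - sInf I.carrier

open Classical in
/-- The space of the interval module of `I` at `t`: it is `𝕜` if `t ∈ I` and `0` otherwise. -/
noncomputable def intervalSpace (𝕜 : Type*) [Field 𝕜] (I : Bar) (t : ℝ) : Submodule 𝕜 𝕜 :=
  if t ∈ I.carrier then ⊤ else ⊥

theorem mem_intervalSpace {𝕜 : Type*} [Field 𝕜] {I : Bar} {t : ℝ} {x : 𝕜} :
    x ∈ intervalSpace 𝕜 I t ↔ (t ∉ I.carrier → x = 0) := by
  unfold intervalSpace
  split_ifs with h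
  · exact ⟨fun _ h' => absurd h h', fun _ => Submodule.mem_top⟩
  · exact ⟨fun hx _ => (Submodule.mem_bot 𝕜).1 hx, fun hx => (Submodule.mem_bot 𝕜).2 (hx h)⟩

open Classical in
/-- The interval module of a bar `I`: it is `𝕜` at `t ∈ I` and `0` elsewhere; the structure map
from `s` to `t` is the identity of `𝕜` if `s, t ∈ I`, and `0` otherwise. -/
noncomputable def intervalModule (𝕜 : Type*) [Field 𝕜] (I : Bar) : PersistenceModule 𝕜 where
  space t := intervalSpace 𝕜 I t
  map {s t} _ := LinearMap.codRestrict (intervalSpace 𝕜 I t)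
    (if s ∈ I.carrier ∧ t ∈ I.carrier then (intervalSpace 𝕜 I s).subtype else 0)
    (fun x => mem_intervalSpace.2 fun ht => by simp [ht])
  map_refl t := by
    ext ⟨x, hx⟩
    by_cases ht : t ∈ I.carrier
    · simp [ht]
    · simp [ht, mem_intervalSpace.1 hx ht]
  map_trans {r s t} hrs hst := by
    ext ⟨x, hx⟩
    by_cases hr : r ∈ I.carrier
    · by_cases ht : t ∈ I.carrier
      · have hs : s ∈ I.carrier := I.ordConnected.out hr ht ⟨hrs, hst⟩
        simp [hr, hs, ht]
      · simp [ht]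
    · have h0 : (⟨x, hx⟩ : intervalSpace 𝕜 I r) = 0 := Subtype.ext (mem_intervalSpace.1 hx hr)
      rw [h0, LinearMap.map_zero, LinearMap.map_zero]

/-- `B` is a barcode of `V`: the persistence module `V` is isomorphic to the direct sum of the
interval modules of the members of the finite multiset `B`. -/
def IsBarcode {𝕜 : Type*} [Field 𝕜] (V : PersistenceModule 𝕜) (B : Multiset Bar) : Prop :=
  ∃ (m : ℕ) (I : Fin m → Bar), Finset.univ.val.map I = B ∧
    Nonempty (V.Iso (PersistenceModule.directSum fun j => intervalModule 𝕜 (I j)))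

open Classical in
/-- The barcode of `V` (a junk value if `V` has none). -/
noncomputable def barcode {𝕜 : Type*} [Field 𝕜] (V : PersistenceModule 𝕜) : Multiset Bar :=
  if h : ∃ B, IsBarcode V B then h.choose else 0

/-- The length of a barcode, i.e. the total length of its bars. For a barcode with exactly one bar
it is the length of this bar, for the empty barcode it is `0`. -/
noncomputable def barcodeLength (B : Multiset Bar) : ℝ := (B.map Bar.length).sum

/-! ## Reduced simplicial homology -/

/-- The ordered simplices with `m` entries of a simplicial complex: the tuples `(v₁, …, v_m)`,
repetitions allowed, whose entries form a face. The empty tuple (`m = 0`) is included; it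
generates the augmentation term. -/
def orderedSimplices {V : Type*} (K : PreAbstractSimplicialComplex V) (m : ℕ) :
    Set (Fin m → V) :=
  {σ | m = 0 ∨ ∃ s ∈ K.faces, (s : Set V) = Set.range σ}

/-- The augmented ordered chain complex of `K`: chains on the ordered simplices with `m` entries,
that is, of dimension `m - 1`. -/
def orderedChains (𝕜 : Type*) [Field 𝕜] {V : Type*} (K : PreAbstractSimplicialComplex V) (m : ℕ) :
    Submodule 𝕜 ((Fin m → V) →₀ 𝕜) :=
  Finsupp.supported 𝕜 𝕜 (orderedSimplices K m)

/-- The simplicial boundary: the alternating sum of the maps that delete the `i`-th entry. -/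
noncomputable def simplicialBoundary (𝕜 : Type*) [Field 𝕜] (V : Type*) (m : ℕ) :
    ((Fin (m + 1) → V) →₀ 𝕜) →ₗ[𝕜] ((Fin m → V) →₀ 𝕜) :=
  ∑ i : Fin (m + 1), (-1 : 𝕜) ^ (i : ℕ) •
    Finsupp.lmapDomain 𝕜 𝕜 fun σ : Fin (m + 1) → V => i.removeNth σ

/-- Reduced cycles of dimension `k`. -/
noncomputable def simplicialCycles (𝕜 : Type*) [Field 𝕜] {V : Type*}
    (K : PreAbstractSimplicialComplex V) (k : ℕ) : Submodule 𝕜 ((Fin (k + 1) → V) →₀ 𝕜) :=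
  orderedChains 𝕜 K (k + 1) ⊓ LinearMap.ker (simplicialBoundary 𝕜 V k)

/-- Boundaries of dimension `k`. -/
noncomputable def simplicialBoundaries (𝕜 : Type*) [Field 𝕜] {V : Type*}
    (K : PreAbstractSimplicialComplex V) (k : ℕ) : Submodule 𝕜 ((Fin (k + 1) → V) →₀ 𝕜) :=
  (orderedChains 𝕜 K (k + 2)).map (simplicialBoundary 𝕜 V (k + 1))

noncomputable instance simplicialCycles.instAddCommGroup (𝕜 : Type*) [Field 𝕜] {V : Type*} (K : PreAbstractSimplicialComplex V)
    (k : ℕ) : AddCommGroup (simplicialCycles 𝕜 K k) :=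
  Submodule.addCommGroup _

/-- The `k`-th reduced simplicial homology of `K` with coefficients in `𝕜`. -/
abbrev ReducedHomology (𝕜 : Type*) [Field 𝕜] {V : Type*}
    (K : PreAbstractSimplicialComplex V) (k : ℕ) : Type _ :=
  simplicialCycles 𝕜 K k ⧸ (simplicialBoundaries 𝕜 K k).submoduleOf (simplicialCycles 𝕜 K k)

theorem orderedChains_mono (𝕜 : Type*) [Field 𝕜] {V : Type*}
    {K L : PreAbstractSimplicialComplex V} (h : K.faces ⊆ L.faces) (m : ℕ) :
    orderedChains 𝕜 K m ≤ orderedChains 𝕜 L m := by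
  refine Finsupp.supported_mono ?_
  rintro σ (hm | ⟨s, hs, hσ⟩)
  · exact Or.inl hm
  · exact Or.inr ⟨s, h hs, hσ⟩

theorem simplicialCycles_mono (𝕜 : Type*) [Field 𝕜] {V : Type*}
    {K L : PreAbstractSimplicialComplex V} (h : K.faces ⊆ L.faces) (k : ℕ) :
    simplicialCycles 𝕜 K k ≤ simplicialCycles 𝕜 L k :=
  inf_le_inf_right _ (orderedChains_mono 𝕜 h _)

/-- The map in reduced homology induced by an inclusion of simplicial complexes. -/
noncomputable def reducedHomologyMap (𝕜 : Type*) [Field 𝕜] {V : Type*}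
    {K L : PreAbstractSimplicialComplex V} (h : K.faces ⊆ L.faces) (k : ℕ) :
    ReducedHomology 𝕜 K k →ₗ[𝕜] ReducedHomology 𝕜 L k :=
  Submodule.mapQ _ _ (Submodule.inclusion (simplicialCycles_mono 𝕜 h k)) fun _ hx =>
    Submodule.map_mono (orderedChains_mono 𝕜 h _) hx

/-! ## Persistent homology of the Čech filtration -/

/-- The Čech complex with parameter `t` of a subset `P` of a metric space `M`: its faces are the
nonempty finite subsets of `P` such that the closed balls of `M` with radius `t` around their
points have a common point (in `M`). -/
def cechComplex {M : Type*} [MetricSpace M] (P : Set M) (t : ℝ) :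
    PreAbstractSimplicialComplex M where
  faces := {s | s.Nonempty ∧ (s : Set M) ⊆ P ∧ (⋂ x ∈ s, Metric.closedBall x t).Nonempty}
  isRelLowerSet_faces := fun _ hs => ⟨hs.1, fun _ hus hu =>
    ⟨hu, (Finset.coe_subset.2 hus).trans hs.2.1,
      hs.2.2.mono <| Set.biInter_subset_biInter_left fun _ hx => hus hx⟩⟩

theorem cechComplex_mono {M : Type*} [MetricSpace M] (P : Set M) {s t : ℝ} (h : s ≤ t) :
    (cechComplex P s).faces ⊆ (cechComplex P t).faces := fun _ hσ =>
  ⟨hσ.1, hσ.2.1, hσ.2.2.mono <| Set.iInter₂_mono fun _ _ => Metric.closedBall_subset_closedBall h⟩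

/-- The persistent homology `PH_k(P)` in degree `k` of a subset `P` of a metric space: the reduced
homology of the Čech filtration of `P`. (For `t < 0` the Čech complex is empty.) -/
noncomputable def persistentHomology (𝕜 : Type*) [Field 𝕜] {M : Type*} [MetricSpace M] (k : ℕ)
    (P : Set M) : PersistenceModule 𝕜 where
  space t := ReducedHomology 𝕜 (cechComplex P t) k
  map h := reducedHomologyMap 𝕜 (cechComplex_mono P h) k
  map_refl t := by
    refine Submodule.linearMap_qext _ ?_
    ext x
    rfl
  map_trans hrs hst := by
    refine Submodule.linearMap_qext _ ?_
    ext x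
    rfl

/-! ## Persistence modules with at most one bar -/

namespace PersistenceModule

/-! The whole persistence module is governed by one number, the largest gap `g` between circularly
consecutive points, measured in full turns. For `0 ≤ t < 1` put `τ = arcsin t / π`. Two points whose
discs meet are at circular distance at most `τ`, and points in an arc of length `τ` have discs with
a common point. Hence edges and triangles behave as on a circle of length one with scale `τ < 1/2`.

Homology is detected by cochains. Cut the circle at a base point: every 1-cocycle is a coboundary on
the resulting line, and all edges over the cut have the same defect, so the first cohomology is
spanned by the cocycle counting crossings of the cut (`IsCircular.winding_generates`). If `τ < g`,
the cut can be placed in a gap that no edge crosses, and the homology vanishes. If `g ≤ τ`, stepping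
from point to point goes once around and gives a cycle on which that cocycle is `1`. For `t ≥ 1` all
discs contain the centre, so the complex is a full simplex. The cocycle does not depend on `t`, so
the identifications with the field are natural and the only bar is `[sin (π g), 1)`, which
disappears when `g ≥ 1/2` (`exists_barcode_circle`). Its length is `1 - sin (π min(g, 1/2))`.

For the expectation, write this sine as the integral of `π cos (π t)` over `t < g`, `t ≤ 1/2`, and
apply Fubini. It remains to find the probability of `t < g`. By inclusion-exclusion this needs the
probability that `k` given points are all followed by gaps longer than `t`. After rotating one point
to the origin, cutting out these `k` intervals is piecewise a translation, which gives `(1 - kt)₊ ^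
(n-1)` (`volume_gapSet`, `measureReal_lt_maxGap`). -/

theorem subsingleton_intervalModule {𝕜 : Type*} [Field 𝕜] {I : Bar} {t : ℝ}
    (ht : t ∉ I.carrier) : Subsingleton ((intervalModule 𝕜 I).space t) :=
  ⟨fun x y => Subtype.ext ((mem_intervalSpace.1 x.2 ht).trans (mem_intervalSpace.1 y.2 ht).symm)⟩

/-- At a point of the bar, the interval module is the field. -/
noncomputable def intervalModuleEquiv (𝕜 : Type*) [Field 𝕜] {I : Bar} {t : ℝ}
    (ht : t ∈ I.carrier) : (intervalModule 𝕜 I).space t ≃ₗ[𝕜] 𝕜 :=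
  LinearEquiv.ofTop (intervalSpace 𝕜 I t) (by simp [intervalSpace, ht])

theorem intervalModuleEquiv_map {𝕜 : Type*} [Field 𝕜] {I : Bar} {s t : ℝ}
    (h : s ≤ t) (hs : s ∈ I.carrier) (ht : t ∈ I.carrier) (x : (intervalModule 𝕜 I).space s) :
    intervalModuleEquiv 𝕜 ht ((intervalModule 𝕜 I).map h x) = intervalModuleEquiv 𝕜 hs x := by
  change ((show intervalSpace 𝕜 I t from (intervalModule 𝕜 I).map h x) : 𝕜) =
    (show intervalSpace 𝕜 I s from x).1
  exact congrArg (fun f : intervalSpace 𝕜 I s →ₗ[𝕜] 𝕜 => f x) (if_pos ⟨hs, ht⟩)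

/-- A persistence module which is naturally the field on a bar and zero elsewhere has this bar as
its barcode. -/
theorem isBarcode_singleton {𝕜 : Type*} [Field 𝕜] {V : PersistenceModule 𝕜} {I : Bar}
    (ψ : ∀ t, t ∈ I.carrier → (V.space t ≃ₗ[𝕜] 𝕜))
    (hψ : ∀ {s t : ℝ} (h : s ≤ t) (hs : s ∈ I.carrier) (ht : t ∈ I.carrier) (x : V.space s),
      ψ t ht (V.map h x) = ψ s hs x)
    (hV : ∀ t, t ∉ I.carrier → Subsingleton (V.space t)) : IsBarcode V {I} := by
  classical
  have key : ∀ t, ∃ φ : V.space t ≃ₗ[𝕜] (intervalModule 𝕜 I).space t,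
      ∀ (ht : t ∈ I.carrier) (x : V.space t), intervalModuleEquiv 𝕜 ht (φ x) = ψ t ht x := by
    intro t
    by_cases ht : t ∈ I.carrier
    · exact ⟨(ψ t ht).trans (intervalModuleEquiv 𝕜 ht).symm, fun _ x => by simp⟩
    · have := hV t ht
      have := subsingleton_intervalModule (𝕜 := 𝕜) ht
      exact ⟨LinearEquiv.ofSubsingleton _ _, fun h => absurd h ht⟩
  choose φ hφ using key
  have hnat : ∀ {s t : ℝ} (h : s ≤ t) (x : V.space s),
      φ t (V.map h x) = (intervalModule 𝕜 I).map h (φ s x) := by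
    intro s t h x
    by_cases ht : t ∈ I.carrier
    · by_cases hs : s ∈ I.carrier
      · apply (intervalModuleEquiv 𝕜 ht).injective
        rw [hφ, hψ h hs ht, intervalModuleEquiv_map h hs ht, hφ]
      · have := hV s hs
        rw [Subsingleton.elim x 0, map_zero, map_zero, map_zero]
        exact (map_zero _).symm
    · have := subsingleton_intervalModule (𝕜 := 𝕜) ht
      exact Subsingleton.elim _ _
  refine ⟨1, fun _ => I, by simp, ⟨⟨fun t => (φ t).trans
    (DirectSum.lid 𝕜 ((intervalModule 𝕜 I).space t) (Fin 1)).symm, ?_⟩⟩⟩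
  intro s t h x
  refine (congrArg (DirectSum.lid 𝕜 ((intervalModule 𝕜 I).space t) (Fin 1)).symm (hnat h x)).trans ?_
  refine (LinearEquiv.symm_apply_eq _).2 (Eq.trans ?_ (DirectSum.lid_apply 𝕜 _).symm)
  refine congrArg ((intervalModule 𝕜 I).map h) ?_
  change φ s x = (DirectSum.lid 𝕜 ((intervalModule 𝕜 I).space s) (Fin 1)).symm (φ s x) default
  rw [← DirectSum.lid_apply 𝕜, LinearEquiv.apply_symm_apply]

theorem isBarcode_zero {𝕜 : Type*} [Field 𝕜] {V : PersistenceModule 𝕜}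
    (hV : ∀ t, Subsingleton (V.space t)) : IsBarcode V 0 := by
  refine ⟨0, fun j => j.elim0, by simp, ⟨⟨fun t => ?_, ?_⟩⟩⟩
  · have := hV t
    have : Subsingleton ((directSum fun j : Fin 0 => intervalModule 𝕜
      (j.elim0 : Bar)).space t) := ⟨fun x y => DFinsupp.ext fun j => j.elim0⟩
    exact LinearEquiv.ofSubsingleton _ _
  · intro s t h x
    exact DFinsupp.ext fun j => j.elim0

/-- Over a point of the bar `J j`, a direct sum of interval modules has an element supported at
`j` only. -/
theorem exists_directSum_generator {𝕜 : Type*} [Field 𝕜] {m : ℕ} (J : Fin m → Bar) {t : ℝ}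
    {j : Fin m} (ht : t ∈ (J j).carrier) :
    ∃ x : DirectSum (Fin m) fun j => (intervalModule 𝕜 (J j)).space t,
      x j ≠ 0 ∧ ∀ i ≠ j, x i = 0 := by
  refine ⟨DirectSum.lof 𝕜 (Fin m) (fun j => (intervalModule 𝕜 (J j)).space t) j
    ((intervalModuleEquiv 𝕜 ht).symm 1), ?_, fun i hi => ?_⟩
  · rw [DirectSum.lof_apply]
    simp
  · rw [DirectSum.lof_eq_of, DirectSum.of_eq_of_ne _ _ _ hi]

theorem IsBarcode.eq_zero {𝕜 : Type*} [Field 𝕜] {V : PersistenceModule 𝕜} {B : Multiset Bar}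
    (hB : IsBarcode V B) (hV : ∀ t, Subsingleton (V.space t)) : B = 0 := by
  obtain ⟨m, J, rfl, ⟨φ⟩⟩ := hB
  rcases Nat.eq_zero_or_pos m with rfl | hm
  · simp
  obtain ⟨t, ht⟩ := (J ⟨0, hm⟩).nonempty
  obtain ⟨x, hx, -⟩ := exists_directSum_generator (𝕜 := 𝕜) J ht
  have := hV t
  have : Subsingleton (DirectSum (Fin m) fun j => (intervalModule 𝕜 (J j)).space t) :=
    (φ.equiv t).symm.toEquiv.subsingleton
  exact absurd (by rw [Subsingleton.elim x 0]; rfl) hx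

/-- No general uniqueness theorem is needed. Spaces of dimension at most one force the bars of any
barcode to be disjoint and to cover `I`, and injectivity of the structure maps inside `I` prevents a
bar from ending before `I` does. Hence there is only one bar. -/
theorem IsBarcode.eq_singleton {𝕜 : Type*} [Field 𝕜] {V : PersistenceModule 𝕜} {I : Bar}
    {B : Multiset Bar} (hB : IsBarcode V B)
    (ψ : ∀ t, t ∈ I.carrier → (V.space t ≃ₗ[𝕜] 𝕜))
    (hψ : ∀ {s t : ℝ} (h : s ≤ t) (hs : s ∈ I.carrier) (ht : t ∈ I.carrier) (x : V.space s),
      ψ t ht (V.map h x) = ψ s hs x)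
    (hV : ∀ t, t ∉ I.carrier → Subsingleton (V.space t)) : B = {I} := by
  obtain ⟨m, J, rfl, ⟨φ⟩⟩ := hB
  let W : ℝ → Type _ := fun t => DirectSum (Fin m) fun j => (intervalModule 𝕜 (J j)).space t
  let χ : ∀ t, t ∈ I.carrier → (W t ≃ₗ[𝕜] 𝕜) := fun t ht => (φ.equiv t).symm.trans (ψ t ht)
  have sub : ∀ j, (J j).carrier ⊆ I.carrier := by
    intro j t ht
    by_contra htI
    obtain ⟨x, hx, -⟩ := exists_directSum_generator (𝕜 := 𝕜) J ht
    have := hV t htI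
    have : Subsingleton (W t) := (φ.equiv t).symm.toEquiv.subsingleton
    exact hx (by rw [Subsingleton.elim (α := W t) x 0]; rfl)
  have disj : ∀ i j t, t ∈ (J i).carrier → t ∈ (J j).carrier → i = j := by
    intro i j t hi hj
    by_contra hij
    obtain ⟨x, hx, hx0⟩ := exists_directSum_generator (𝕜 := 𝕜) J hi
    obtain ⟨y, hy, hy0⟩ := exists_directSum_generator (𝕜 := 𝕜) J hj
    have htI := sub i hi
    have hne : χ t htI y ≠ 0 := by
      rw [Ne, LinearEquiv.map_eq_zero_iff]
      rintro rfl
      exact hy rfl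
    -- In a one-dimensional space `x` and `y` are proportional; the `i`-th component of this
    -- relation contradicts their disjoint supports.
    have h0 : χ t htI y • x - χ t htI x • y = 0 := by
      rw [← (χ t htI).map_eq_zero_iff]
      erw [map_sub, map_smul, map_smul]
      simp [mul_comm]
    have h1 := congrArg (fun z : W t => z i) h0
    simp only [DirectSum.sub_apply, DirectSum.smul_apply, DirectSum.zero_apply, hy0 i hij,
      smul_zero, sub_zero, smul_eq_zero] at h1
    exact h1.elim hne hx
  have cover : ∀ t ∈ I.carrier, ∃ j, t ∈ (J j).carrier := by
    intro t ht
    by_contra! hall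
    have : Subsingleton (W t) := ⟨fun x y => DFinsupp.ext fun j =>
      (subsingleton_intervalModule (𝕜 := 𝕜) (hall j)).elim _ _⟩
    exact one_ne_zero (((χ t ht).symm.toEquiv.subsingleton).elim (1 : 𝕜) 0)
  -- A generator of a bar ending before `t` would be killed by the structure map, which is injective
  -- inside `I`.
  have forward : ∀ s t j, s ≤ t → t ∈ I.carrier → s ∈ (J j).carrier → t ∈ (J j).carrier := by
    intro s t j h ht hs
    by_contra htj
    obtain ⟨x, hx, hx0⟩ := exists_directSum_generator (𝕜 := 𝕜) J hs
    have hz : (directSum fun j => intervalModule 𝕜 (J j)).map h x = 0 := by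
      refine DFinsupp.ext fun i => ?_
      erw [DirectSum.lmap_apply]
      by_cases hij : i = j
      · subst hij
        exact (subsingleton_intervalModule (𝕜 := 𝕜) htj).elim _ _
      · rw [hx0 i hij, map_zero]; rfl
    have h1 := φ.naturality h ((φ.equiv s).symm x)
    erw [LinearEquiv.apply_symm_apply (φ.equiv s) x, hz, LinearEquiv.map_eq_zero_iff] at h1
    have h2 := hψ h (sub j hs) ht ((φ.equiv s).symm x)
    rw [h1, map_zero, eq_comm, LinearEquiv.map_eq_zero_iff] at h2
    have h3 : x = 0 := (φ.equiv s).symm.map_eq_zero_iff.1 h2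
    exact hx (by rw [h3]; rfl)
  obtain ⟨s, hs⟩ := I.nonempty
  obtain ⟨j, hj⟩ := cover s hs
  have hJ : J j = I := by
    refine Bar.ext ((sub j).antisymm fun t ht => ?_)
    rcases le_total s t with h | h
    · exact forward s t j h ht hj
    · obtain ⟨i, hi⟩ := cover t ht
      rwa [disj j i s hj (forward t s i h hs hi)]
  have hall : ∀ i, i = j := fun i => by
    obtain ⟨t, ht⟩ := (J i).nonempty
    exact disj i j t ht (hJ ▸ sub i ht)
  have hm : m = 1 := by
    have : Subsingleton (Fin m) := ⟨fun a b => (hall a).trans (hall b).symm⟩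
    have h1 := Fintype.card_le_one_iff_subsingleton.2 this
    rw [Fintype.card_fin] at h1
    have := j.pos
    omega
  subst hm
  obtain rfl : j = 0 := Subsingleton.elim _ _
  simp [hJ]

end PersistenceModule

theorem barcode_eq {𝕜 : Type*} [Field 𝕜] {V : PersistenceModule 𝕜} {B : Multiset Bar}
    (hB : IsBarcode V B) (huniq : ∀ B', IsBarcode V B' → B' = B) : barcode V = B := by
  have h : ∃ B, IsBarcode V B := ⟨B, hB⟩
  rw [barcode, dif_pos h]
  exact huniq _ h.choose_spec

/-! ## The first homology and cocycles -/

theorem simplicialBoundary_single_two {𝕜 : Type*} [Field 𝕜] {V : Type*} (x y : V) :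
    simplicialBoundary 𝕜 V 1 (Finsupp.single ![x, y] 1) =
      Finsupp.single ![y] 1 - Finsupp.single ![x] 1 := by
  have h0 : (0 : Fin 2).removeNth ![x, y] = ![y] := by ext i; fin_cases i; rfl
  have h1 : (1 : Fin 2).removeNth ![x, y] = ![x] := by ext i; fin_cases i; rfl
  simp only [simplicialBoundary, LinearMap.sum_apply, LinearMap.smul_apply,
    Finsupp.lmapDomain_apply, Finsupp.mapDomain_single]
  refine (Fin.sum_univ_two _).trans ?_
  rw [h0, h1]
  simp [sub_eq_add_neg]

theorem simplicialBoundary_single_three {𝕜 : Type*} [Field 𝕜] {V : Type*} (x y z : V) :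
    simplicialBoundary 𝕜 V 2 (Finsupp.single ![x, y, z] 1) =
      Finsupp.single ![y, z] 1 - Finsupp.single ![x, z] 1 + Finsupp.single ![x, y] 1 := by
  have h0 : (0 : Fin 3).removeNth ![x, y, z] = ![y, z] := by ext i; fin_cases i <;> rfl
  have h1 : (1 : Fin 3).removeNth ![x, y, z] = ![x, z] := by ext i; fin_cases i <;> rfl
  have h2 : (2 : Fin 3).removeNth ![x, y, z] = ![x, y] := by ext i; fin_cases i <;> rfl
  simp only [simplicialBoundary, LinearMap.sum_apply, LinearMap.smul_apply,
    Finsupp.lmapDomain_apply, Finsupp.mapDomain_single]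
  refine (Fin.sum_univ_three _).trans ?_
  rw [h0, h1, h2]
  simp [sub_eq_add_neg]

/-- The evaluation of a 1-cochain on 1-chains. -/
noncomputable def evalCochain (𝕜 : Type*) [Field 𝕜] {V : Type*} (w : V → V → 𝕜) :
    ((Fin 2 → V) →₀ 𝕜) →ₗ[𝕜] 𝕜 :=
  Finsupp.linearCombination 𝕜 fun σ => w (σ 0) (σ 1)

@[simp]
theorem evalCochain_single {𝕜 : Type*} [Field 𝕜] {V : Type*} (w : V → V → 𝕜) (x y : V) :
    evalCochain 𝕜 w (Finsupp.single ![x, y] 1) = w x y := by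
  simp [evalCochain]

/-- The cocycle condition for a 1-cochain on a simplicial complex. -/
def IsCocycle {𝕜 : Type*} [Field 𝕜] {V : Type*} (K : PreAbstractSimplicialComplex V)
    (f : V → V → 𝕜) : Prop :=
  ∀ x y z, ![x, y, z] ∈ orderedSimplices K 3 → f y z - f x z + f x y = 0

theorem linearMap_eqOn_orderedChains {𝕜 : Type*} [Field 𝕜] {V : Type*} {M : Type*}
    [AddCommGroup M] [Module 𝕜 M] {K : PreAbstractSimplicialComplex V} {m : ℕ}
    {φ ψ : ((Fin m → V) →₀ 𝕜) →ₗ[𝕜] M}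
    (h : ∀ σ ∈ orderedSimplices K m, φ (Finsupp.single σ 1) = ψ (Finsupp.single σ 1))
    {z : (Fin m → V) →₀ 𝕜} (hz : z ∈ orderedChains 𝕜 K m) : φ z = ψ z := by
  rw [orderedChains, Finsupp.supported_eq_span_single] at hz
  refine LinearMap.eqOn_span (f := φ) (g := ψ) ?_ hz
  rintro _ ⟨σ, hσ, rfl⟩
  exact h σ hσ

theorem eq_vec_two {V : Type*} (σ : Fin 2 → V) : σ = ![σ 0, σ 1] := by
  ext i; fin_cases i <;> rfl

theorem eq_vec_three {V : Type*} (σ : Fin 3 → V) : σ = ![σ 0, σ 1, σ 2] := by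
  ext i; fin_cases i <;> rfl

/-- A cocycle vanishes on boundaries. -/
theorem evalCochain_eq_zero_of_mem_boundaries {𝕜 : Type*} [Field 𝕜] {V : Type*}
    {K : PreAbstractSimplicialComplex V} {w : V → V → 𝕜} (hw : IsCocycle K w)
    {z : (Fin 2 → V) →₀ 𝕜} (hz : z ∈ simplicialBoundaries 𝕜 K 1) : evalCochain 𝕜 w z = 0 := by
  obtain ⟨c, hc, rfl⟩ := hz
  refine linearMap_eqOn_orderedChains (K := K)
    (φ := evalCochain 𝕜 w ∘ₗ simplicialBoundary 𝕜 V 2) (ψ := 0) (fun σ hσ => ?_) hc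
  rw [eq_vec_three σ] at hσ ⊢
  rw [LinearMap.comp_apply, simplicialBoundary_single_three]
  simpa using hw _ _ _ hσ

/-- If the class of `w` generates the first cohomology, then it detects homology classes. -/
theorem mem_boundaries_of_evalCochain_eq_zero {𝕜 : Type*} [Field 𝕜] {V : Type*}
    {K : PreAbstractSimplicialComplex V} {w : V → V → 𝕜}
    (H : ∀ f : V → V → 𝕜, IsCocycle K f → ∃ (F : V → 𝕜) (c : 𝕜), ∀ x y,
      ![x, y] ∈ orderedSimplices K 2 → f x y = F y - F x + c * w x y)
    {z : (Fin 2 → V) →₀ 𝕜} (hz : z ∈ simplicialCycles 𝕜 K 1) (hwz : evalCochain 𝕜 w z = 0) :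
    z ∈ simplicialBoundaries 𝕜 K 1 := by
  by_contra hzB
  -- A functional that separates `z` from the boundaries is, on edges, a cocycle. By `H` it is then
  -- a coboundary plus a multiple of `w`, and both parts vanish on `z`.
  obtain ⟨φ, hφz, hφ⟩ := Submodule.exists_le_ker_of_notMem hzB
  refine hφz ?_
  obtain ⟨F, c, hF⟩ := H (fun x y => φ (Finsupp.single ![x, y] 1)) (fun x y z hxyz => by
    rw [← map_sub, ← map_add, ← simplicialBoundary_single_three]
    refine hφ ⟨_, ?_, rfl⟩
    exact Finsupp.single_mem_supported 𝕜 1 hxyz)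
  have h := linearMap_eqOn_orderedChains (K := K) (φ := φ)
    (ψ := (Finsupp.linearCombination 𝕜 fun σ : Fin 1 → V => F (σ 0)) ∘ₗ simplicialBoundary 𝕜 V 1 +
      c • evalCochain 𝕜 w) (fun σ hσ => ?_) hz.1
  · have hz2 : simplicialBoundary 𝕜 V 1 z = 0 := hz.2
    rw [h, LinearMap.add_apply, LinearMap.comp_apply, hz2, LinearMap.smul_apply, hwz]
    simp
  · rw [eq_vec_two σ] at hσ ⊢
    rw [LinearMap.add_apply, LinearMap.comp_apply]
    erw [simplicialBoundary_single_two]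
    rw [hF _ _ hσ]
    simp

theorem subsingleton_reducedHomology_one {𝕜 : Type*} [Field 𝕜] {V : Type*}
    {K : PreAbstractSimplicialComplex V}
    (H : ∀ f : V → V → 𝕜, IsCocycle K f → ∃ F : V → 𝕜, ∀ x y,
      ![x, y] ∈ orderedSimplices K 2 → f x y = F y - F x) :
    Subsingleton (ReducedHomology 𝕜 K 1) := by
  refine subsingleton_of_forall_eq 0 fun x => ?_
  obtain ⟨⟨z, hz⟩, rfl⟩ := Submodule.Quotient.mk_surjective _ x
  refine (Submodule.Quotient.mk_eq_zero _).2 ?_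
  change z ∈ simplicialBoundaries 𝕜 K 1
  refine mem_boundaries_of_evalCochain_eq_zero (w := fun _ _ => 0) (fun f hf => ?_) hz ?_
  · obtain ⟨F, hF⟩ := H f hf
    exact ⟨F, 0, fun x y hxy => by rw [hF x y hxy]; simp⟩
  · simp [evalCochain, Finsupp.linearCombination_apply]

/-- A cocycle which generates the first cohomology and is `1` on some cycle identifies the first
homology with the field. -/
noncomputable def reducedHomologyEquiv {𝕜 : Type*} [Field 𝕜] {V : Type*}
    {K : PreAbstractSimplicialComplex V} {w : V → V → 𝕜} (hw : IsCocycle K w)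
    (H : ∀ f : V → V → 𝕜, IsCocycle K f → ∃ (F : V → 𝕜) (c : 𝕜), ∀ x y,
      ![x, y] ∈ orderedSimplices K 2 → f x y = F y - F x + c * w x y)
    (h1 : ∃ z ∈ simplicialCycles 𝕜 K 1, evalCochain 𝕜 w z = 1) :
    ReducedHomology 𝕜 K 1 ≃ₗ[𝕜] 𝕜 :=
  LinearEquiv.ofBijective
    (Submodule.liftQ _ (evalCochain 𝕜 w ∘ₗ (simplicialCycles 𝕜 K 1).subtype)
      fun z hz => evalCochain_eq_zero_of_mem_boundaries hw hz)
    ⟨(injective_iff_map_eq_zero _).2 fun x hx => by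
      obtain ⟨z, rfl⟩ := Submodule.Quotient.mk_surjective _ x
      exact (Submodule.Quotient.mk_eq_zero _).2
        (mem_boundaries_of_evalCochain_eq_zero H z.2 hx), fun c => by
      obtain ⟨z, hz, hz1⟩ := h1
      refine ⟨Submodule.Quotient.mk (c • ⟨z, hz⟩), ?_⟩
      change evalCochain 𝕜 w (c • z) = c
      rw [map_smul, hz1, smul_eq_mul, mul_one]⟩

theorem reducedHomologyEquiv_map {𝕜 : Type*} [Field 𝕜] {V : Type*}
    {K L : PreAbstractSimplicialComplex V} {w : V → V → 𝕜} (hK : IsCocycle K w)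
    (HK : ∀ f : V → V → 𝕜, IsCocycle K f → ∃ (F : V → 𝕜) (c : 𝕜), ∀ x y,
      ![x, y] ∈ orderedSimplices K 2 → f x y = F y - F x + c * w x y)
    (hK1 : ∃ z ∈ simplicialCycles 𝕜 K 1, evalCochain 𝕜 w z = 1) (hL : IsCocycle L w)
    (HL : ∀ f : V → V → 𝕜, IsCocycle L f → ∃ (F : V → 𝕜) (c : 𝕜), ∀ x y,
      ![x, y] ∈ orderedSimplices L 2 → f x y = F y - F x + c * w x y)
    (hL1 : ∃ z ∈ simplicialCycles 𝕜 L 1, evalCochain 𝕜 w z = 1) (h : K.faces ⊆ L.faces)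
    (x : ReducedHomology 𝕜 K 1) :
    reducedHomologyEquiv hL HL hL1 (reducedHomologyMap 𝕜 h 1 x) =
      reducedHomologyEquiv hK HK hK1 x := by
  obtain ⟨z, rfl⟩ := Submodule.Quotient.mk_surjective _ x
  rfl

/-! ### First cohomology of a complex on a circle -/

theorem mem_orderedSimplices_pair_of_triple {V : Type*} {K : PreAbstractSimplicialComplex V}
    {x y : V} (h : ![x, y, y] ∈ orderedSimplices K 3) : ![x, y] ∈ orderedSimplices K 2 := by
  obtain h | ⟨s, hs, hr⟩ := h
  · simp at h
  · refine Or.inr ⟨s, hs, hr.trans ?_⟩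
    simp [Matrix.range_cons]

/-- The vertices are at positions `Θ` in `(0, 1]`, which is viewed as a circle of length one,
and the edges and triangles of `K` are determined by the circular distance `τ`. -/
structure IsCircular {V : Type*} (K : PreAbstractSimplicialComplex V) (P : Finset V) (Θ : V → ℝ)
    (τ : ℝ) : Prop where
  lt_half : τ < 1 / 2
  pos : ∀ x ∈ P, 0 < Θ x
  le_one : ∀ x ∈ P, Θ x ≤ 1
  edge : ∀ x y, ![x, y] ∈ orderedSimplices K 2 →
    x ∈ P ∧ y ∈ P ∧ ∃ m : ℤ, |Θ y - Θ x + m| ≤ τ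
  triangle : ∀ x ∈ P, ∀ y ∈ P, ∀ z ∈ P, ∀ (α : ℝ) (a b c : ℤ), Θ x + a ∈ Set.Icc α (α + τ) →
    Θ y + b ∈ Set.Icc α (α + τ) → Θ z + c ∈ Set.Icc α (α + τ) →
    ![x, y, z] ∈ orderedSimplices K 3

/-- The 1-cochain counting how often an edge passes the base point of the circle. -/
noncomputable def windingCochain (𝕜 : Type*) [Field 𝕜] {V : Type*} (Θ : V → ℝ) (x y : V) : 𝕜 :=
  ((-round (Θ y - Θ x) : ℤ) : 𝕜)

/-- The lift of the displacement to `(-1/2, 1/2)` is unique, so rounding recovers the signed number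
of crossings of the base point. -/
theorem windingCochain_eq {𝕜 : Type*} [Field 𝕜] {V : Type*} {Θ : V → ℝ} {x y : V} {m : ℤ}
    (h : |Θ y - Θ x + m| < 1 / 2) : windingCochain 𝕜 Θ x y = m := by
  have : round (Θ y - Θ x) = -m := by
    rw [round_eq, Int.floor_eq_iff]
    obtain ⟨h1, h2⟩ := abs_lt.1 h
    push_cast
    constructor <;> linarith
  rw [windingCochain, this, neg_neg]

/-- On points of the line, a function on the pairs at distance at most `τ` which is additive on
triples of diameter at most `τ` is a coboundary. -/
theorem exists_potential_line {𝕜 : Type*} [Field 𝕜] {V : Type*} (Θ : V → ℝ) {τ : ℝ} (hτ : 0 ≤ τ)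
    (f : V → V → 𝕜) (S : Finset V)
    (hf : ∀ x ∈ S, ∀ y ∈ S, ∀ z ∈ S, ∀ α : ℝ, Θ x ∈ Set.Icc α (α + τ) → Θ y ∈ Set.Icc α (α + τ) →
      Θ z ∈ Set.Icc α (α + τ) → f y z - f x z + f x y = 0) :
    ∃ F : V → 𝕜, ∀ x ∈ S, ∀ y ∈ S, |Θ y - Θ x| ≤ τ → f x y = F y - F x := by
  classical
  -- Points are added from left to right, so the neighbours of the new point `a` all lie in the
  -- interval `[Θ a - τ, Θ a]` and form triangles with it.
  induction S using Finset.induction_on_max_value Θ with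
  | empty => exact ⟨0, by simp⟩
  | insert a S ha hmax ih =>
    obtain ⟨F, hF⟩ := ih fun x hx y hy z hz => hf x (Finset.mem_insert_of_mem hx) y
      (Finset.mem_insert_of_mem hy) z (Finset.mem_insert_of_mem hz)
    have haS := Finset.mem_insert_self a S
    have hdiag : f a a = 0 := by
      have := hf a haS a haS a haS (Θ a) ⟨le_rfl, by linarith⟩ ⟨le_rfl, by linarith⟩
        ⟨le_rfl, by linarith⟩
      simpa using this
    -- Any one neighbour `q` determines the value at `a`; the triangle `q, x, a` shows that another
    -- neighbour `x` gives the same value.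
    have key : ∃ v : 𝕜, ∀ x ∈ S, Θ a - τ ≤ Θ x → f x a = v - F x := by
      by_cases h : ∃ q ∈ S, Θ a - τ ≤ Θ q
      · obtain ⟨q, hq, hqa⟩ := h
        refine ⟨F q + f q a, fun x hx hxa => ?_⟩
        have h1 := hf q (Finset.mem_insert_of_mem hq) x (Finset.mem_insert_of_mem hx) a haS
          (Θ a - τ) ⟨hqa, by linarith [hmax q hq]⟩ ⟨hxa, by linarith [hmax x hx]⟩
          ⟨by linarith, by linarith⟩
        have h2 := hF q hq x hx (abs_le.2 ⟨by linarith [hmax q hq], by linarith [hmax x hx]⟩)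
        linear_combination h1 - h2
      · push Not at h
        exact ⟨0, fun x hx hxa => absurd hxa (not_le.2 (h x hx))⟩
    obtain ⟨v, hv⟩ := key
    have hne : ∀ x ∈ S, x ≠ a := fun x hx h => ha (h ▸ hx)
    refine ⟨Function.update F a v, fun x hx y hy hxy => ?_⟩
    rw [abs_le] at hxy
    rcases Finset.mem_insert.1 hx with rfl | hx'
    · rcases Finset.mem_insert.1 hy with rfl | hy'
      · simp [hdiag]
      · rw [Function.update_self, Function.update_of_ne (hne y hy')]
        have h1 := hf x haS y hy x haS (Θ x - τ) ⟨by linarith, by linarith⟩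
          ⟨by linarith, by linarith [hmax y hy']⟩ ⟨by linarith, by linarith⟩
        have h2 := hv y hy' (by linarith)
        linear_combination h1 + hdiag - h2
    · rcases Finset.mem_insert.1 hy with rfl | hy'
      · rw [Function.update_self, Function.update_of_ne (hne x hx')]
        exact hv x hx' (by linarith)
      · rw [Function.update_of_ne (hne x hx'), Function.update_of_ne (hne y hy')]
        exact hF x hx' y hy' (abs_le.2 hxy)

namespace IsCircular

variable {𝕜 : Type*} [Field 𝕜] {V : Type*} {K : PreAbstractSimplicialComplex V} {P : Finset V}
  {Θ : V → ℝ} {τ : ℝ}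

/-- The potential `F` of the cut-open circle handles the edges that avoid the base point. The
constant `c` is the defect of the edge from the last vertex `hi` to the first vertex `lo`. -/
theorem winding_generates (hK : IsCircular K P Θ τ) (f : V → V → 𝕜) (hf : IsCocycle K f) :
    ∃ (F : V → 𝕜) (c : 𝕜), ∀ x y, ![x, y] ∈ orderedSimplices K 2 →
      f x y = F y - F x + c * windingCochain 𝕜 Θ x y := by
  rcases P.eq_empty_or_nonempty with rfl | hP
  · exact ⟨0, 0, fun x y h => absurd (hK.edge x y h).1 (Finset.notMem_empty x)⟩
  rcases lt_or_ge τ 0 with hτ | hτ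
  · refine ⟨0, 0, fun x y h => ?_⟩
    obtain ⟨m, hm⟩ := (hK.edge x y h).2.2
    exact absurd (hm.trans_lt hτ) (not_lt.2 (abs_nonneg _))
  obtain ⟨F, hF⟩ := exists_potential_line Θ hτ f P fun x hx y hy z hz α h1 h2 h3 =>
    hf x y z (hK.triangle x hx y hy z hz α 0 0 0 (by simpa using h1) (by simpa using h2)
      (by simpa using h3))
  obtain ⟨lo, hlo, hmin⟩ := P.exists_min_image Θ hP
  obtain ⟨hi, hhi, hmax⟩ := P.exists_max_image Θ hP
  have hlt := hK.lt_half
  -- The arc of an edge `x, y` over the base point contains `hi` and `lo`. The triangles `x, hi, y`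
  -- and `hi, lo, y` replace the edge by the path `x, hi, lo, y`, whose outer edges do not cross.
  have wrap : ∀ x ∈ P, ∀ y ∈ P, |Θ y - Θ x + 1| ≤ τ →
      f x y = F y - F x + (F hi - F lo + f hi lo) := by
    intro x hx y hy hxy
    rw [abs_le] at hxy
    have b1 := hmax x hx
    have b2 := hmin y hy
    have b3 := hK.pos lo hlo
    have b4 := hK.le_one hi hhi
    have h1 := hf x hi y (hK.triangle x hx hi hhi y hy (Θ x) 0 0 1
      (by simpa using hτ) (by constructor <;> push_cast <;> linarith)
      (by constructor <;> push_cast <;> linarith))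
    have h2 := hf hi lo y (hK.triangle hi hhi lo hlo y hy (Θ x) 0 1 1
      (by constructor <;> push_cast <;> linarith) (by constructor <;> push_cast <;> linarith)
      (by constructor <;> push_cast <;> linarith))
    have h3 := hF x hx hi hhi (abs_le.2 ⟨by linarith, by linarith⟩)
    have h4 := hF lo hlo y hy (abs_le.2 ⟨by linarith, by linarith⟩)
    linear_combination h3 + h4 - h1 - h2
  refine ⟨F, F hi - F lo + f hi lo, fun x y h => ?_⟩
  obtain ⟨hx, hy, m, hm⟩ := hK.edge x y h
  rw [windingCochain_eq (hm.trans_lt hlt)]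
  have hm' := abs_le.1 hm
  have a1 := hK.pos x hx
  have a2 := hK.pos y hy
  have a3 := hK.le_one x hx
  have a4 := hK.le_one y hy
  have m1 : m < 2 := by exact_mod_cast (by linarith : (m : ℝ) < 2)
  have m2 : -2 < m := by exact_mod_cast (by linarith : (-2 : ℝ) < m)
  obtain rfl | rfl | rfl : m = -1 ∨ m = 0 ∨ m = 1 := by omega
  -- A backward crossing is the reverse of a forward one; the degenerate triangles `x, y, x` and `x,
  -- x, x` give antisymmetry of `f`.
  · push_cast at hm' ⊢
    have h1 := wrap y hy x hx (abs_le.2 ⟨by linarith, by linarith⟩)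
    have h2 := hf x y x (hK.triangle x hx y hy x hx (Θ y - 1) 0 (-1) 0
      (by constructor <;> push_cast <;> linarith) (by constructor <;> push_cast <;> linarith)
      (by constructor <;> push_cast <;> linarith))
    have h3 := hf x x x (hK.triangle x hx x hx x hx (Θ x) 0 0 0
      (by simpa using hτ) (by simpa using hτ) (by simpa using hτ))
    linear_combination h2 + h3 - h1
  · rw [hF x hx y hy (by simpa using hm)]
    simp
  · rw [wrap x hx y hy (by simpa using hm)]
    simp

/-- If there is no edge across the base point, then the first homology vanishes. -/
theorem subsingleton_homology (hK : IsCircular K P Θ τ)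
    (hgap : ∀ x ∈ P, τ < Θ x) : Subsingleton (ReducedHomology 𝕜 K 1) := by
  refine subsingleton_reducedHomology_one fun f hf => ?_
  obtain ⟨F, c, hF⟩ := hK.winding_generates f hf
  refine ⟨F, fun x y h => ?_⟩
  rw [hF x y h]
  obtain ⟨hx, hy, m, hm⟩ := hK.edge x y h
  rw [windingCochain_eq (hm.trans_lt hK.lt_half)]
  rw [abs_le] at hm
  have a1 := hgap x hx
  have a2 := hgap y hy
  have a3 := hK.le_one x hx
  have a4 := hK.le_one y hy
  have m1 : m < 1 := by exact_mod_cast (by linarith : (m : ℝ) < 1)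
  have m2 : -1 < m := by exact_mod_cast (by linarith : (-1 : ℝ) < m)
  obtain rfl : m = 0 := by omega
  simp

/-- If every point has a successor at forward distance at most `τ`, then there is a cycle around
the circle. -/
theorem exists_cycle (hK : IsCircular K P Θ τ) {p : V} (hp : p ∈ P) (hp1 : Θ p = 1)
    (hnext : ∀ x ∈ P, ∃ y ∈ P, (Θ x < Θ y ∧ Θ y ≤ Θ x + τ) ∨ (Θ y ≤ Θ x ∧ Θ y + 1 ≤ Θ x + τ)) :
    ∃ z ∈ simplicialCycles 𝕜 K 1, evalCochain 𝕜 (windingCochain 𝕜 Θ) z = 1 := by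
  classical
  have hlt := hK.lt_half
  have edge : ∀ x ∈ P, ∀ y ∈ P, ∀ m : ℤ, 0 ≤ Θ y + m - Θ x → Θ y + m - Θ x ≤ τ →
      ![x, y] ∈ orderedSimplices K 2 ∧ windingCochain 𝕜 Θ x y = m := by
    intro x hx y hy m h0 h1
    refine ⟨mem_orderedSimplices_pair_of_triple (hK.triangle x hx y hy y hy (Θ x) 0 m m
      (by constructor <;> push_cast <;> linarith) (by constructor <;> linarith)
      (by constructor <;> linarith)), windingCochain_eq (abs_lt.2 ⟨by linarith, by linarith⟩)⟩
  have path : ∀ x ∈ P, ∃ c ∈ orderedChains 𝕜 K 2, simplicialBoundary 𝕜 V 1 c =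
      Finsupp.single ![p] 1 - Finsupp.single ![x] 1 ∧
      evalCochain 𝕜 (windingCochain 𝕜 Θ) c = 0 := by
    -- Among the points without such a path, take the one farthest along; its successor yields a
    -- contradiction.
    by_contra! hbad
    obtain ⟨x₀, hx₀, hbad₀⟩ := hbad
    obtain ⟨x, hx, hxmax⟩ := (P.filter fun x => ∀ c ∈ orderedChains 𝕜 K 2,
      simplicialBoundary 𝕜 V 1 c = Finsupp.single ![p] 1 - Finsupp.single ![x] 1 →
      evalCochain 𝕜 (windingCochain 𝕜 Θ) c ≠ 0).exists_max_image Θ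
        ⟨x₀, Finset.mem_filter.2 ⟨hx₀, hbad₀⟩⟩
    rw [Finset.mem_filter] at hx
    obtain ⟨hxP, hx⟩ := hx
    obtain ⟨y, hy, ⟨h1, h2⟩ | ⟨h1, h2⟩⟩ := hnext x hxP
    · have : ∃ c ∈ orderedChains 𝕜 K 2, simplicialBoundary 𝕜 V 1 c =
          Finsupp.single ![p] 1 - Finsupp.single ![y] 1 ∧
          evalCochain 𝕜 (windingCochain 𝕜 Θ) c = 0 := by
        by_contra! hy'
        exact absurd (hxmax y (Finset.mem_filter.2 ⟨hy, hy'⟩)) (not_le.2 h1)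
      obtain ⟨c, hc, hc1, hc2⟩ := this
      obtain ⟨e1, e2⟩ := edge x hxP y hy 0 (by push_cast; linarith) (by push_cast; linarith)
      refine hx (Finsupp.single ![x, y] 1 + c)
        (add_mem (Finsupp.single_mem_supported 𝕜 1 e1) hc) ?_ ?_
      · rw [map_add, simplicialBoundary_single_two, hc1]
        abel
      · rw [map_add, evalCochain_single, e2, hc2]
        simp
    -- The successor lies beyond the base point, so `p`, at position `1`, is itself within reach of
    -- `x`.
    · have := hK.pos y hy
      have := hK.le_one x hxP
      obtain ⟨e1, e2⟩ := edge x hxP p hp 0 (by push_cast; linarith) (by push_cast; linarith)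
      refine hx (Finsupp.single ![x, p] 1) (Finsupp.single_mem_supported 𝕜 1 e1) ?_ ?_
      · rw [simplicialBoundary_single_two]
      · rw [evalCochain_single, e2]
        simp
  -- The step leaving `p` is the only one to cross the base point, and it carries the winding number
  -- `1`.
  obtain ⟨y, hy, h | ⟨h1, h2⟩⟩ := hnext p hp
  · linarith [hK.le_one y hy]
  obtain ⟨e1, e2⟩ := edge p hp y hy 1 (by push_cast; linarith [hK.pos y hy])
    (by push_cast; linarith)
  obtain ⟨c, hc, hc1, hc2⟩ := path y hy
  refine ⟨Finsupp.single ![p, y] 1 + c,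
    ⟨add_mem (Finsupp.single_mem_supported 𝕜 1 e1) hc, ?_⟩, ?_⟩
  · change simplicialBoundary 𝕜 V 1 _ = 0
    rw [map_add, simplicialBoundary_single_two, hc1]
    abel
  · rw [map_add, evalCochain_single, e2, hc2]
    simp

end IsCircular

/-! ## Čech complexes of points on the circle -/

theorem mem_orderedSimplices_cechComplex {M : Type*} [MetricSpace M] {P : Set M} {t : ℝ} {m : ℕ}
    {σ : Fin (m + 1) → M} : σ ∈ orderedSimplices (cechComplex P t) (m + 1) ↔
      (∀ i, σ i ∈ P) ∧ ∃ c, ∀ i, dist c (σ i) ≤ t := by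
  classical
  constructor
  · rintro (h | ⟨s, ⟨-, hsP, c, hc⟩, hs⟩)
    · simp at h
    have hmem : ∀ i, σ i ∈ s := fun i => by
      rw [← Finset.mem_coe, hs]
      exact Set.mem_range_self i
    exact ⟨fun i => hsP (hmem i), c, fun i => Set.mem_iInter₂.1 hc _ (hmem i)⟩
  · rintro ⟨hP, c, hc⟩
    refine Or.inr ⟨Finset.univ.image σ, ⟨⟨σ 0, by simp⟩, ?_, c, ?_⟩, by simp⟩
    · rintro _ hx
      obtain ⟨i, -, rfl⟩ := Finset.mem_image.1 hx
      exact hP i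
    · refine Set.mem_iInter₂.2 fun x hx => ?_
      obtain ⟨i, -, rfl⟩ := Finset.mem_image.1 hx
      exact hc i

/-- The point of the unit circle at the position `θ`, measured in full turns. -/
noncomputable def circlePoint (θ : ℝ) : EuclideanSpace ℝ (Fin 2) :=
  !₂[Real.cos (2 * Real.pi * θ), Real.sin (2 * Real.pi * θ)]

/-- The polar angle of a point of the plane, in full turns. -/
noncomputable def turn (x : EuclideanSpace ℝ (Fin 2)) : ℝ :=
  Complex.arg ⟨x 0, x 1⟩ / (2 * Real.pi)

theorem norm_toComplex (x : EuclideanSpace ℝ (Fin 2)) : ‖(⟨x 0, x 1⟩ : ℂ)‖ = ‖x‖ := by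
  rw [EuclideanSpace.norm_eq, Complex.norm_def, Complex.normSq_apply]
  simp [Fin.sum_univ_two, sq]

/-- The origin is included: there the factor `‖x‖ = 0` makes the conventional value of the angle
irrelevant. This allows polar coordinates for an arbitrary centre of a disc. -/
theorem norm_smul_circlePoint_turn (x : EuclideanSpace ℝ (Fin 2)) :
    ‖x‖ • circlePoint (turn x) = x := by
  have h2 : 2 * Real.pi * turn x = Complex.arg ⟨x 0, x 1⟩ := by
    rw [turn]
    field_simp
  ext i
  rw [circlePoint, h2, ← norm_toComplex x]
  fin_cases i
  · simp [Complex.norm_mul_cos_arg]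
  · simp [Complex.norm_mul_sin_arg]

theorem circlePoint_turn {x : EuclideanSpace ℝ (Fin 2)} (hx : ‖x‖ = 1) :
    circlePoint (turn x) = x := by
  simpa [hx] using norm_smul_circlePoint_turn x

theorem circlePoint_add_int (θ : ℝ) (m : ℤ) : circlePoint (θ + m) = circlePoint θ := by
  have h : 2 * Real.pi * (θ + m) = 2 * Real.pi * θ + m * (2 * Real.pi) := by ring
  simp only [circlePoint, h, Real.cos_add_int_mul_two_pi, Real.sin_add_int_mul_two_pi]

theorem dist_smul_circlePoint_sq (r a b : ℝ) :
    dist (r • circlePoint a) (circlePoint b) ^ 2 =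
      1 + r ^ 2 - 2 * r * Real.cos (2 * Real.pi * (b - a)) := by
  rw [EuclideanSpace.dist_eq, Real.sq_sqrt (by positivity), mul_sub, Real.cos_sub]
  simp only [Fin.sum_univ_two, Real.dist_eq, sq_abs, circlePoint, PiLp.smul_apply, smul_eq_mul,
    PiLp.toLp_apply, Matrix.cons_val_zero, Matrix.cons_val_one]
  linear_combination (r ^ 2) * Real.sin_sq_add_cos_sq (2 * Real.pi * a) +
    Real.sin_sq_add_cos_sq (2 * Real.pi * b)

theorem dist_circlePoint (a b : ℝ) :
    dist (circlePoint a) (circlePoint b) = 2 * |Real.sin (Real.pi * (b - a))| := by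
  have h := dist_smul_circlePoint_sq 1 a b
  have h2 : 2 * Real.pi * (b - a) = 2 * (Real.pi * (b - a)) := by ring
  rw [one_smul, h2, Real.cos_two_mul] at h
  rw [← sq_eq_sq₀ dist_nonneg (by positivity), h, mul_pow, sq_abs]
  linear_combination (-4) * Real.sin_sq_add_cos_sq (Real.pi * (b - a))

/-- The forward distance on the circle of length one between two points with difference `u`, as a
number in `(0, 1]`. -/
noncomputable def forwardGap (u : ℝ) : ℝ := 1 - Int.fract (-u)

theorem forwardGap_pos (u : ℝ) : 0 < forwardGap u := sub_pos.2 (Int.fract_lt_one _)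

theorem forwardGap_le_one (u : ℝ) : forwardGap u ≤ 1 := sub_le_self _ (Int.fract_nonneg _)

theorem forwardGap_eq {u : ℝ} {m : ℤ} (h0 : 0 < u + m) (h1 : u + m ≤ 1) :
    forwardGap u = u + m := by
  have : Int.fract (-u) = 1 - u - m := by
    rw [Int.fract_eq_iff]
    refine ⟨by linarith, by linarith, m - 1, ?_⟩
    push_cast
    ring
  rw [forwardGap, this]
  ring

theorem exists_forwardGap_eq (u : ℝ) : ∃ m : ℤ, forwardGap u = u + m :=
  ⟨1 + ⌊-u⌋, by rw [forwardGap, Int.fract]; push_cast; ring⟩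

theorem forwardGap_add_int (u : ℝ) (k : ℤ) : forwardGap (u + k) = forwardGap u := by
  obtain ⟨m, hm⟩ := exists_forwardGap_eq (u + k)
  have h : forwardGap (u + k) = u + ((k + m : ℤ) : ℝ) := by rw [hm]; push_cast; ring
  have h0 := forwardGap_pos (u + k)
  have h1 := forwardGap_le_one (u + k)
  rw [h] at h0 h1
  rw [h, forwardGap_eq h0 h1]

/-- The position of a point of the circle relative to `q`, in `(0, 1]`. -/
noncomputable def position (q x : EuclideanSpace ℝ (Fin 2)) : ℝ := forwardGap (turn x - turn q)

theorem circlePoint_position (q : EuclideanSpace ℝ (Fin 2)) {x : EuclideanSpace ℝ (Fin 2)}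
    (hx : ‖x‖ = 1) (a : ℤ) : circlePoint (turn q + (position q x + a)) = x := by
  obtain ⟨m, hm⟩ := exists_forwardGap_eq (turn x - turn q)
  have h : turn q + (position q x + a) = turn x + ((m + a : ℤ) : ℝ) := by
    rw [position, hm]
    push_cast
    ring
  rw [h, circlePoint_add_int, circlePoint_turn hx]

/-- A chord over `d ≤ 1/2` turns has length `2 sin (π d)`, and discs of radius `t` can meet only if
this is at most `2t`. Conversely, an arc of length `τ` lies in the disc of radius `sin (π τ) = t`
around the midpoint of its chord. -/
theorem isCircular_cechComplex {P : Finset (EuclideanSpace ℝ (Fin 2))} (hP : ∀ x ∈ P, ‖x‖ = 1)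
    (q : EuclideanSpace ℝ (Fin 2)) {t : ℝ} (ht0 : 0 ≤ t) (ht1 : t < 1) :
    IsCircular (cechComplex (P : Set (EuclideanSpace ℝ (Fin 2))) t) P (position q)
      (Real.arcsin t / Real.pi) := by
  have hpi := Real.pi_pos
  have hasin : Real.arcsin t < Real.pi / 2 := Real.arcsin_lt_pi_div_two.2 ht1
  have hasin0 : 0 ≤ Real.arcsin t := Real.arcsin_nonneg.2 ht0
  have hτ : Real.arcsin t / Real.pi < 1 / 2 := by
    rw [div_lt_iff₀ hpi]
    linarith
  refine ⟨hτ, fun x _ => forwardGap_pos _, fun x _ => forwardGap_le_one _, ?_, ?_⟩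
  · intro x y hxy
    obtain ⟨hmem, c, hc⟩ := mem_orderedSimplices_cechComplex.1 hxy
    have hx : x ∈ P := hmem 0
    have hy : y ∈ P := hmem 1
    refine ⟨hx, hy, -round (position q y - position q x), ?_⟩
    have hcx : dist c x ≤ t := hc 0
    have hcy : dist c y ≤ t := hc 1
    have hd : dist x y ≤ 2 * t := (dist_triangle_left x y c).trans (by linarith)
    rw [← circlePoint_position q (hP x hx) 0,
      ← circlePoint_position q (hP y hy) (-round (position q y - position q x)),
      dist_circlePoint] at hd
    set d := position q y - position q x + ((-round (position q y - position q x) : ℤ) : ℝ) with hdd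
    have hdarg : turn q + (position q y + ((-round (position q y - position q x) : ℤ) : ℝ)) -
        (turn q + (position q x + ((0 : ℤ) : ℝ))) = d := by
      rw [hdd]; push_cast; ring
    rw [hdarg] at hd
    have hdhalf : |d| ≤ 1 / 2 := by
      have := abs_sub_round (position q y - position q x)
      rwa [hdd, Int.cast_neg, ← sub_eq_add_neg]
    have habs : |Real.sin (Real.pi * d)| = Real.sin (Real.pi * |d|) := by
      rcases abs_cases d with ⟨h1, h2⟩ | ⟨h1, h2⟩
      · rw [h1, abs_of_nonneg]
        exact Real.sin_nonneg_of_nonneg_of_le_pi (by positivity) (by nlinarith)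
      · rw [h1, mul_neg, Real.sin_neg, abs_of_nonpos]
        exact Real.sin_nonpos_of_nonpos_of_neg_pi_le (by nlinarith) (by nlinarith)
    rw [habs] at hd
    rw [le_div_iff₀ hpi, mul_comm]
    refine (Real.le_arcsin_iff_sin_le' ⟨?_, ?_⟩).2 (by linarith)
    · have := abs_nonneg d
      nlinarith
    · nlinarith
  · intro x hx y hy z hz α a b c ha hb hc
    set τ := Real.arcsin t / Real.pi with hτdef
    have hπτ : Real.pi * τ = Real.arcsin t := by rw [hτdef]; field_simp
    have hsin : Real.sin (Real.pi * τ) = t := by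
      rw [hπτ, Real.sin_arcsin (by linarith) ht1.le]
    have hC : 0 ≤ Real.cos (Real.pi * τ) := by rw [hπτ]; exact Real.cos_arcsin_nonneg t
    -- The centre is the chord midpoint, at distance `r = cos (π τ)` from the origin. The squared
    -- distance is at most `1 + r² - 2r·r = 1 - r² = t²`.
    have key : ∀ x ∈ P, ∀ a : ℤ, position q x + a ∈ Set.Icc α (α + τ) →
        dist (Real.cos (Real.pi * τ) • circlePoint (turn q + (α + τ / 2))) x ≤ t := by
      intro x hx a ha
      rw [← circlePoint_position q (hP x hx) a]
      refine abs_le_of_sq_le_sq' ?_ ht0 |>.2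
      rw [dist_smul_circlePoint_sq]
      have hcos : Real.cos (Real.pi * τ) ≤ Real.cos (2 * Real.pi *
          (turn q + (position q x + a) - (turn q + (α + τ / 2)))) := by
        rw [← Real.cos_abs (2 * Real.pi * _)]
        refine Real.cos_le_cos_of_nonneg_of_le_pi (abs_nonneg _) (by linarith) ?_
        rw [abs_le]
        constructor
        · nlinarith [ha.1]
        · nlinarith [ha.2]
      have := Real.sin_sq_add_cos_sq (Real.pi * τ)
      rw [hsin] at this
      nlinarith
    refine mem_orderedSimplices_cechComplex.2 ⟨fun i => ?_,
      Real.cos (Real.pi * τ) • circlePoint (turn q + (α + τ / 2)), fun i => ?_⟩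
    · fin_cases i
      exacts [hx, hy, hz]
    · fin_cases i
      exacts [key x hx a ha, key y hy b hb, key z hz c hc]

/-- If a disc of radius `t < 1` around `c` contains a point of the circle, that point is less than a
quarter turn away from the direction of `c`. So the vertices of a triangle have lifts within `1/4`
of one value, and the cochain is the difference of the lifting integers. -/
theorem isCocycle_windingCochain {𝕜 : Type*} [Field 𝕜] {P : Set (EuclideanSpace ℝ (Fin 2))}
    (hP : ∀ x ∈ P, ‖x‖ = 1) (q : EuclideanSpace ℝ (Fin 2)) {t : ℝ} (ht1 : t < 1) :
    IsCocycle (cechComplex P t) (windingCochain 𝕜 (position q)) := by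
  intro x y z h
  obtain ⟨hmem, c, hc⟩ := mem_orderedSimplices_cechComplex.1 h
  have hx : x ∈ P := hmem 0
  have hy : y ∈ P := hmem 1
  have hz : z ∈ P := hmem 2
  have hcx : dist c x ≤ t := hc 0
  have hcy : dist c y ≤ t := hc 1
  have hcz : dist c z ≤ t := hc 2
  have key : ∀ x ∈ P, dist c x ≤ t →
      ∃ m : ℤ, |position q x + m - (turn c - turn q)| < 1 / 4 := by
    intro x hx hcx
    set m := -round (position q x - (turn c - turn q)) with hm
    refine ⟨m, ?_⟩
    have hhalf : |position q x + m - (turn c - turn q)| ≤ 1 / 2 := by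
      have := abs_sub_round (position q x - (turn c - turn q))
      have h2 : position q x + m - (turn c - turn q) = position q x - (turn c - turn q) -
          round (position q x - (turn c - turn q)) := by rw [hm]; push_cast; ring
      rwa [h2]
    have h1 : dist c x ^ 2 < 1 := by
      have := dist_nonneg (x := c) (y := x)
      nlinarith
    nth_rewrite 1 [← norm_smul_circlePoint_turn c] at h1
    rw [← circlePoint_position q (hP x hx) m, dist_smul_circlePoint_sq] at h1
    have harg : turn q + (position q x + m) - turn c =
        position q x + m - (turn c - turn q) := by ring
    rw [harg, ← Real.cos_abs, abs_mul, abs_of_pos Real.two_pi_pos] at h1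
    by_contra hge
    rw [not_lt] at hge
    have hpi := Real.pi_pos
    have := Real.cos_nonpos_of_pi_div_two_le_of_le
      -- At a quarter turn or more the cosine is nonpositive, so the squared distance would be at
      -- least `1 + ‖c‖²`.
      (x := 2 * Real.pi * |position q x + m - (turn c - turn q)|) (by nlinarith) (by nlinarith)
    nlinarith [norm_nonneg c]
  obtain ⟨a, ha⟩ := key x hx hcx
  obtain ⟨b, hb⟩ := key y hy hcy
  obtain ⟨d, hd⟩ := key z hz hcz
  rw [abs_lt] at ha hb hd
  rw [windingCochain_eq (m := d - b) (by rw [abs_lt]; push_cast; constructor <;> linarith),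
    windingCochain_eq (m := d - a) (by rw [abs_lt]; push_cast; constructor <;> linarith),
    windingCochain_eq (m := b - a) (by rw [abs_lt]; push_cast; constructor <;> linarith)]
  push_cast
  ring

/-- The centre of the circle lies in every disc, so the complex is a cone with any point `p` as
apex, and `f p` is a potential for `f`. -/
theorem subsingleton_homology_cechComplex_of_one_le {𝕜 : Type*} [Field 𝕜]
    {P : Set (EuclideanSpace ℝ (Fin 2))} (hP : ∀ x ∈ P, ‖x‖ = 1) (hne : P.Nonempty) {t : ℝ}
    (ht : 1 ≤ t) : Subsingleton (ReducedHomology 𝕜 (cechComplex P t) 1) := by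
  obtain ⟨p, hp⟩ := hne
  refine subsingleton_reducedHomology_one fun f hf => ⟨f p, fun x y hxy => ?_⟩
  have hmem := (mem_orderedSimplices_cechComplex.1 hxy).1
  have := hf p x y (mem_orderedSimplices_cechComplex.2 ⟨fun i => ?_, 0, fun i => ?_⟩)
  · linear_combination this
  · fin_cases i
    exacts [hp, hmem 0, hmem 1]
  · rw [dist_zero_left]
    refine le_trans (le_of_eq (hP _ ?_)) ht
    fin_cases i
    exacts [hp, hmem 0, hmem 1]

theorem subsingleton_homology_cechComplex_of_neg {𝕜 : Type*} [Field 𝕜] {M : Type*} [MetricSpace M]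
    {P : Set M} {t : ℝ} (ht : t < 0) : Subsingleton (ReducedHomology 𝕜 (cechComplex P t) 1) := by
  refine subsingleton_reducedHomology_one fun f _ => ⟨0, fun x y hxy => ?_⟩
  obtain ⟨c, hc⟩ := (mem_orderedSimplices_cechComplex.1 hxy).2
  exact absurd (dist_nonneg.trans (hc 0)) (not_le.2 ht)

/-- The largest gap between circularly consecutive points with positions `θ` on the circle of
length one. -/
noncomputable def maxGap {ι : Type*} (θ : ι → ℝ) : ℝ := ⨆ i, ⨅ j, forwardGap (θ j - θ i)

/-- The index `j = i` is included and is harmless: `forwardGap 0 = 1`. Coincident points therefore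
create no gap of length zero, and a single point has gap `1`. -/
theorem lt_maxGap_iff {ι : Type*} [Finite ι] [Nonempty ι] {θ : ι → ℝ} {s : ℝ} :
    s < maxGap θ ↔ ∃ i, ∀ j, s < forwardGap (θ j - θ i) := by
  rw [maxGap, lt_ciSup_iff (Set.finite_range _).bddAbove]
  refine exists_congr fun i => ⟨fun h j => h.trans_le (ciInf_le (Set.finite_range _).bddBelow j),
    fun h => ?_⟩
  obtain ⟨j, hj⟩ := exists_eq_ciInf_of_finite (f := fun j => forwardGap (θ j - θ i))
  rw [← hj]
  exact h j

theorem maxGap_pos {ι : Type*} [Finite ι] [Nonempty ι] (θ : ι → ℝ) : 0 < maxGap θ :=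
  lt_maxGap_iff.2 ⟨Classical.arbitrary ι, fun _ => forwardGap_pos _⟩

/-! ### The barcode of finitely many points on the circle -/

section

variable {𝕜 : Type*} [Field 𝕜] {ι : Type*} [Finite ι] [Nonempty ι]
  {p : ι → EuclideanSpace ℝ (Fin 2)} {t : ℝ}

/-- The base point is the point at which a gap longer than `τ` starts, so no edge crosses it. -/
theorem subsingleton_homology_of_lt_maxGap (hp : ∀ i, ‖p i‖ = 1) (ht0 : 0 ≤ t) (ht1 : t < 1)
    (h : Real.arcsin t / Real.pi < maxGap fun i => turn (p i)) :
    Subsingleton (ReducedHomology 𝕜 (cechComplex (Set.range p) t) 1) := by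
  classical
  obtain ⟨i, hi⟩ := lt_maxGap_iff.1 h
  have hK := isCircular_cechComplex (P := (Set.finite_range p).toFinset) (by simpa using hp)
    (p i) ht0 ht1
  rw [Set.Finite.coe_toFinset] at hK
  refine hK.subsingleton_homology fun x hx => ?_
  obtain ⟨j, rfl⟩ : ∃ j, p j = x := by simpa using hx
  exact hi j

omit [Nonempty ι] in
theorem winding_generates_cechComplex (hp : ∀ i, ‖p i‖ = 1) (q : EuclideanSpace ℝ (Fin 2))
    (ht0 : 0 ≤ t) (ht1 : t < 1) (f : EuclideanSpace ℝ (Fin 2) → EuclideanSpace ℝ (Fin 2) → 𝕜)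
    (hf : IsCocycle (cechComplex (Set.range p) t) f) :
    ∃ (F : EuclideanSpace ℝ (Fin 2) → 𝕜) (c : 𝕜), ∀ x y,
      ![x, y] ∈ orderedSimplices (cechComplex (Set.range p) t) 2 →
      f x y = F y - F x + c * windingCochain 𝕜 (position q) x y := by
  have hK := isCircular_cechComplex (P := (Set.finite_range p).toFinset) (by simpa using hp)
    q ht0 ht1
  rw [Set.Finite.coe_toFinset] at hK
  exact hK.winding_generates f hf

theorem exists_cycle_cechComplex (hp : ∀ i, ‖p i‖ = 1) (i₀ : ι) (ht0 : 0 ≤ t) (ht1 : t < 1)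
    (h : (maxGap fun i => turn (p i)) ≤ Real.arcsin t / Real.pi) :
    ∃ z ∈ simplicialCycles 𝕜 (cechComplex (Set.range p) t) 1,
      evalCochain 𝕜 (windingCochain 𝕜 (position (p i₀))) z = 1 := by
  have hK := isCircular_cechComplex (P := (Set.finite_range p).toFinset) (by simpa using hp)
    (p i₀) ht0 ht1
  rw [Set.Finite.coe_toFinset] at hK
  refine hK.exists_cycle (p := p i₀) (by simp) ?_ fun x hx => ?_
  · rw [position, sub_self, forwardGap_eq (m := 1)] <;> simp
  obtain ⟨i, rfl⟩ : ∃ i, p i = x := by simpa using hx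
  have hi := mt lt_maxGap_iff.2 (not_lt.2 h)
  push Not at hi
  obtain ⟨j, hj⟩ := hi i
  refine ⟨p j, by simp, ?_⟩
  obtain ⟨a, ha⟩ := exists_forwardGap_eq (turn (p i) - turn (p i₀))
  obtain ⟨b, hb⟩ := exists_forwardGap_eq (turn (p j) - turn (p i₀))
  have hi0 : 0 < position (p i₀) (p i) := forwardGap_pos _
  have hi1 : position (p i₀) (p i) ≤ 1 := forwardGap_le_one _
  have hj0 : 0 < position (p i₀) (p j) := forwardGap_pos _
  have hj1 : position (p i₀) (p j) ≤ 1 := forwardGap_le_one _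
  have hd : forwardGap (turn (p j) - turn (p i)) =
      forwardGap (position (p i₀) (p j) - position (p i₀) (p i)) := by
    rw [position, position, ha, hb, ← forwardGap_add_int _ (b - a)]
    congr 1
    push_cast
    ring
  rw [hd] at hj
  rcases lt_or_ge (position (p i₀) (p i)) (position (p i₀) (p j)) with hlt | hle
  · refine Or.inl ⟨hlt, ?_⟩
    rw [forwardGap_eq (m := 0) (by push_cast; linarith) (by push_cast; linarith)] at hj
    push_cast at hj
    linarith
  · refine Or.inr ⟨hle, ?_⟩
    rw [forwardGap_eq (m := 1) (by push_cast; linarith) (by push_cast; linarith)] at hj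
    push_cast at hj
    linarith

/-- The bar `[a, 1)`. -/
noncomputable def barToOne {a : ℝ} (ha : a < 1) : Bar where
  carrier := Set.Ico a 1
  nonempty := Set.nonempty_Ico.2 ha
  ordConnected := Set.ordConnected_Ico
  isBounded := Metric.isBounded_Ico a 1

/-- The first persistent homology of finitely many points on the unit circle has exactly one
barcode; it has at most one bar, and its length is determined by the largest gap. -/
theorem exists_barcode_circle (𝕜 : Type*) [Field 𝕜] {p : ι → EuclideanSpace ℝ (Fin 2)}
    (hp : ∀ i, ‖p i‖ = 1) :
    ∃ B, IsBarcode (persistentHomology 𝕜 1 (Set.range p)) B ∧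
      (∀ B', IsBarcode (persistentHomology 𝕜 1 (Set.range p)) B' → B' = B) ∧
      Multiset.card B ≤ 1 ∧ barcodeLength B =
        1 - Real.sin (Real.pi * min (maxGap fun i => turn (p i)) (1 / 2)) := by
  set g := maxGap fun i => turn (p i) with hg
  have hg0 : 0 < g := maxGap_pos _
  have hpi := Real.pi_pos
  have hP : ∀ x ∈ Set.range p, ‖x‖ = 1 := by rintro _ ⟨i, rfl⟩; exact hp i
  have hout : ∀ t, t < 0 ∨ 1 ≤ t ∨ Real.arcsin t / Real.pi < g →
      Subsingleton ((persistentHomology 𝕜 1 (Set.range p)).space t) := by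
    intro t ht
    rcases lt_or_ge t 0 with h0 | h0
    · exact subsingleton_homology_cechComplex_of_neg h0
    rcases le_or_gt 1 t with h1 | h1
    · exact subsingleton_homology_cechComplex_of_one_le hP (Set.range_nonempty p) h1
    · exact subsingleton_homology_of_lt_maxGap hp h0 h1
        ((ht.resolve_left (not_lt.2 h0)).resolve_left (not_le.2 h1))
  rcases lt_or_ge g (1 / 2) with hlt | hge
  · have hpg : Real.pi * g < Real.pi / 2 := by nlinarith
    have hpg0 : 0 < Real.pi * g := by positivity
    have hsin0 : 0 < Real.sin (Real.pi * g) := Real.sin_pos_of_pos_of_lt_pi hpg0 (by linarith)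
    have hsin1 : Real.sin (Real.pi * g) < 1 := by
      rw [← Real.sin_pi_div_two]
      exact Real.sin_lt_sin_of_lt_of_le_pi_div_two (by linarith) le_rfl hpg
    -- For `t < -1` the clamped value of `arcsin` is negative, and both sides are false.
    have hiff : ∀ t, t ≤ 1 → (Real.sin (Real.pi * g) ≤ t ↔ g ≤ Real.arcsin t / Real.pi) := by
      intro t ht
      rw [le_div_iff₀ hpi, mul_comm g]
      rcases lt_or_ge t (-1) with h1 | h1
      · rw [Real.arcsin_of_le_neg_one h1.le]
        constructor <;> intro h <;> linarith
      · exact (Real.le_arcsin_iff_sin_le ⟨by linarith, hpg.le⟩ ⟨h1, ht⟩).symm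
    have hmem : ∀ t ∈ (barToOne hsin1).carrier,
        0 ≤ t ∧ t < 1 ∧ g ≤ Real.arcsin t / Real.pi := fun t ht =>
      ⟨hsin0.le.trans ht.1, ht.2, (hiff t ht.2.le).1 ht.1⟩
    have hnot : ∀ t, t ∉ (barToOne hsin1).carrier →
        Subsingleton ((persistentHomology 𝕜 1 (Set.range p)).space t) := by
      intro t ht
      refine hout t ?_
      by_cases h1 : 1 ≤ t
      · exact Or.inr (Or.inl h1)
      · refine Or.inr (Or.inr ?_)
        rw [not_le] at h1
        by_contra h
        exact ht ⟨(hiff t h1.le).2 (not_lt.1 h), h1⟩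
    let i₀ : ι := Classical.arbitrary ι
    -- The same cochain, with the same base point, is used for all `t`; this makes the
    -- identifications natural.
    let ψ : ∀ t, t ∈ (barToOne hsin1).carrier →
        ((persistentHomology 𝕜 1 (Set.range p)).space t ≃ₗ[𝕜] 𝕜) := fun t ht =>
      reducedHomologyEquiv (isCocycle_windingCochain hP (p i₀) (hmem t ht).2.1)
        (winding_generates_cechComplex hp (p i₀) (hmem t ht).1 (hmem t ht).2.1)
        (exists_cycle_cechComplex hp i₀ (hmem t ht).1 (hmem t ht).2.1 (hmem t ht).2.2)
    have hψ : ∀ {s t : ℝ} (h : s ≤ t) (hs : s ∈ (barToOne hsin1).carrier)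
        (ht : t ∈ (barToOne hsin1).carrier) (x), ψ t ht
          ((persistentHomology 𝕜 1 (Set.range p)).map h x) = ψ s hs x := fun h hs ht x =>
      reducedHomologyEquiv_map _ _ _ _ _ _ (cechComplex_mono _ h) x
    refine ⟨{barToOne hsin1}, PersistenceModule.isBarcode_singleton ψ hψ hnot,
      fun B' hB' => PersistenceModule.IsBarcode.eq_singleton hB' ψ hψ hnot, by simp, ?_⟩
    rw [min_eq_left hlt.le]
    simp [barcodeLength, Bar.length, barToOne, csSup_Ico hsin1, csInf_Ico hsin1]
  -- For `t < 1` the scale `τ` is below `1/2 ≤ g`, so no cycle ever closes up.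
  · have hall : ∀ t, Subsingleton ((persistentHomology 𝕜 1 (Set.range p)).space t) := by
      intro t
      refine hout t ?_
      by_cases h1 : 1 ≤ t
      · exact Or.inr (Or.inl h1)
      · refine Or.inr (Or.inr (lt_of_lt_of_le ?_ hge))
        rw [div_lt_iff₀ hpi]
        linarith [Real.arcsin_lt_pi_div_two.2 (not_le.1 h1)]
    refine ⟨0, PersistenceModule.isBarcode_zero hall, fun B' hB' =>
      PersistenceModule.IsBarcode.eq_zero hB' hall, by simp, ?_⟩
    rw [min_eq_right hge, mul_one_div, Real.sin_pi_div_two]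
    simp [barcodeLength]

end

open MeasureTheory

/-! ## The distribution of the largest gap -/

/-- Configurations in the box `(0, L)^ι` in which every point with index in `I` is followed by an
interval of length `s` which contains no further point and no boundary point of the box. -/
def gapSet {ι : Type*} (I : Finset ι) (L s : ℝ) : Set (ι → ℝ) :=
  {x | (∀ j, 0 < x j ∧ x j < L) ∧ ∀ i ∈ I, x i + s < L ∧ ∀ j, x j ≤ x i ∨ x i + s < x j}

theorem ae_ne_coordinate {ι : Type*} [Fintype ι] (i : ι) :
    ∀ᵐ x : ι → ℝ, ∀ j, j ≠ i → x j ≠ x i := by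
  classical
  refine ae_all_iff.2 fun j => ?_
  by_cases hji : j = i
  · exact Filter.Eventually.of_forall fun x h => absurd hji h
  let W : Submodule ℝ (ι → ℝ) :=
    LinearMap.ker (LinearMap.proj (R := ℝ) (φ := fun _ : ι => ℝ) j - LinearMap.proj i)
  have hW : W ≠ ⊤ := by
    intro h
    have h1 : (Pi.single j 1 : ι → ℝ) ∈ W := h ▸ Submodule.mem_top
    simp [W, Ne.symm hji] at h1
  have h0 := Measure.addHaar_submodule volume W hW
  rw [← compl_compl (W : Set (ι → ℝ))] at h0
  filter_upwards [mem_ae_iff.2 h0] with x hx _ hxx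
  exact hx (by simp [W, hxx])

/-- `A` is the set of points beyond `x i`, and `y` arises by deleting the empty interval after `x i`
and moving these points back by `s`. Points coinciding with `x i` are excluded because they would
share its gap and lose it. -/
theorem mem_gapSet_insert_iff {ι : Type*} [DecidableEq ι] {I A : Finset ι} {i : ι}
    (hiI : i ∉ I) {L s : ℝ} (hs : 0 ≤ s) {x y : ι → ℝ} (hxy : ∀ j, y j = if j ∈ A then x j - s else x j)
    (hi : ∀ j, j ≠ i → x j ≠ x i) :
    ((∀ j, j ∈ A ↔ x i < x j) ∧ x ∈ gapSet (insert i I) L s) ↔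
      ((∀ j, j ∈ A ↔ y i < y j) ∧ y ∈ gapSet I (L - s) s) := by
  have hA : ∀ j ∈ A, y j = x j - s := fun j hj => by rw [hxy, if_pos hj]
  have hN : ∀ j ∉ A, y j = x j := fun j hj => by rw [hxy, if_neg hj]
  constructor
  · rintro ⟨hR, hbox, hgap⟩
    have hiA : i ∉ A := fun h => lt_irrefl _ ((hR i).1 h)
    obtain ⟨hiL, hig⟩ := hgap i (Finset.mem_insert_self i I)
    have hpos := (hbox i).1
    have hup : ∀ j ∈ A, x i + s < x j := fun j hj =>
      (hig j).resolve_left (not_le.2 ((hR j).1 hj))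
    have hdn : ∀ j ∉ A, x j ≤ x i := fun j hj => not_lt.1 fun h => hj ((hR j).2 h)
    refine ⟨fun j => ?_, fun j => ?_, fun k hk => ?_⟩
    · rw [hN i hiA]
      by_cases hj : j ∈ A
      · simpa [hj, hA j hj, lt_sub_iff_add_lt] using hup j hj
      · simpa [hj, hN j hj] using hdn j hj
    · by_cases hj : j ∈ A
      · have := hup j hj
        have := hbox j
        rw [hA j hj]
        constructor <;> linarith
      · have := hdn j hj
        have := hbox j
        rw [hN j hj]
        constructor <;> linarith
    · obtain ⟨hkL, hkg⟩ := hgap k (Finset.mem_insert_of_mem hk)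
      by_cases hkA : k ∈ A
      · have := hup k hkA
        rw [hA k hkA]
        refine ⟨by linarith, fun j => ?_⟩
        by_cases hj : j ∈ A
        · rw [hA j hj]
          rcases hkg j with h | h
          · exact Or.inl (by linarith)
          · exact Or.inr (by linarith)
        · have := hdn j hj
          rw [hN j hj]
          exact Or.inl (by linarith)
      · have hki : x k < x i := lt_of_le_of_ne (hdn k hkA) (hi k fun h => hiI (h ▸ hk))
        have := (hkg i).resolve_left (not_le.2 hki)
        rw [hN k hkA]
        refine ⟨by linarith, fun j => ?_⟩
        by_cases hj : j ∈ A
        · have := hup j hj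
          rw [hA j hj]
          exact Or.inr (by linarith)
        · rw [hN j hj]
          exact hkg j
  · rintro ⟨hR, hbox, hgap⟩
    have hiA : i ∉ A := fun h => lt_irrefl _ ((hR i).1 h)
    have hyi := hN i hiA
    have hiL := hbox i
    rw [hyi] at hiL
    have hup : ∀ j ∈ A, x i + s < x j := fun j hj => by
      have := (hR j).1 hj
      rw [hA j hj, hyi] at this
      linarith
    have hdn : ∀ j ∉ A, x j ≤ x i := fun j hj => by
      have := not_lt.1 fun h => hj ((hR j).2 h)
      rwa [hN j hj, hyi] at this
    refine ⟨fun j => ?_, fun j => ?_, fun k hk => ?_⟩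
    · by_cases hj : j ∈ A
      · have := hup j hj
        simp only [hj, true_iff]
        linarith
      · simpa [hj] using hdn j hj
    · have := hbox j
      by_cases hj : j ∈ A
      · rw [hA j hj] at this
        have := hup j hj
        constructor <;> linarith
      · rw [hN j hj] at this
        constructor <;> linarith
    · rcases Finset.mem_insert.1 hk with rfl | hk
      · refine ⟨by linarith, fun j => ?_⟩
        by_cases hj : j ∈ A
        · exact Or.inr (hup j hj)
        · exact Or.inl (hdn j hj)
      · obtain ⟨hkL, hkg⟩ := hgap k hk
        by_cases hkA : k ∈ A
        · have := hup k hkA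
          rw [hA k hkA] at hkL
          refine ⟨by linarith, fun j => ?_⟩
          by_cases hj : j ∈ A
          · have h := hkg j
            rw [hA j hj, hA k hkA] at h
            rcases h with h | h
            · exact Or.inl (by linarith)
            · exact Or.inr (by linarith)
          · have := hdn j hj
            exact Or.inl (by linarith)
        · have hki : x k < x i := lt_of_le_of_ne (hdn k hkA) (hi k fun h => hiI (h ▸ hk))
          have h := hkg i
          rw [hyi, hN k hkA] at h
          have := h.resolve_left (not_le.2 hki)
          refine ⟨by linarith, fun j => ?_⟩
          by_cases hj : j ∈ A
          · have := hup j hj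
            exact Or.inr (by linarith)
          · have h := hkg j
            rwa [hN j hj, hN k hkA] at h

/-- Split the configurations by the set `A` of points beyond the `i`-th. On each piece, deleting the
gap is a translation, hence preserves volume; coincidences form a null set. -/
theorem volume_gapSet_insert {ι : Type*} [Fintype ι] [DecidableEq ι] {I : Finset ι} {i : ι}
    (hi : i ∉ I) {L s : ℝ} (hs : 0 ≤ s) :
    volume (gapSet (insert i I) L s) = volume (gapSet I (L - s) s) := by
  let a : (ι → ℝ) → Finset ι := fun x => Finset.univ.filter fun j => x i < x j
  have ha : ∀ A x, a x = A ↔ ∀ j, j ∈ A ↔ x i < x j := fun A x => by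
    simp only [a, Finset.ext_iff, Finset.mem_filter, Finset.mem_univ, true_and]
    exact forall_congr' fun j => Iff.comm
  have hmeas : ∀ A ∈ (Finset.univ : Finset (Finset ι)), MeasurableSet (a ⁻¹' {A}) := by
    intro A _
    have : a ⁻¹' {A} = ⋂ j, {x | j ∈ A ↔ x i < x j} := by
      ext x
      simp [ha]
    rw [this]
    refine MeasurableSet.iInter fun j => ?_
    exact MeasurableSet.iff (MeasurableSet.const _)
      (measurableSet_lt (measurable_pi_apply i) (measurable_pi_apply j))
  have hsum : ∀ S : Set (ι → ℝ), volume S = ∑ A : Finset ι, volume (a ⁻¹' {A} ∩ S) := by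
    intro S
    have := sum_measure_preimage_singleton (μ := volume.restrict S) Finset.univ hmeas
    rw [Finset.coe_univ, Set.preimage_univ, Measure.restrict_apply_univ] at this
    rw [← this]
    exact Finset.sum_congr rfl fun A hA => Measure.restrict_apply (hmeas A hA)
  rw [hsum (gapSet (insert i I) L s), hsum (gapSet I (L - s) s)]
  refine Finset.sum_congr rfl fun A _ => ?_
  let v : ι → ℝ := fun j => if j ∈ A then s else 0
  rw [← measure_preimage_add_right volume (-v) (a ⁻¹' {A} ∩ gapSet I (L - s) s)]
  refine measure_congr ?_
  filter_upwards [ae_ne_coordinate i] with x hx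
  refine propext ?_
  change (a x = A ∧ _) ↔ (a (x + -v) = A ∧ _)
  rw [ha, ha]
  exact mem_gapSet_insert_iff hi hs (fun j => by
    simp only [v, Pi.add_apply, Pi.neg_apply]
    split_ifs <;> simp [sub_eq_add_neg]) hx

theorem volume_gapSet {ι : Type*} [Fintype ι] (I : Finset ι) (L : ℝ) {s : ℝ} (hs : 0 ≤ s) :
    volume (gapSet I L s) = ENNReal.ofReal (L - I.card * s) ^ Fintype.card ι := by
  classical
  induction I using Finset.induction_on generalizing L with
  | empty =>
    have : gapSet (∅ : Finset ι) L s = Set.pi Set.univ fun _ => Set.Ioo 0 L := by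
      ext x
      simp [gapSet]
    rw [this, Real.volume_pi_Ioo]
    simp
  | insert i I hi ih =>
    rw [volume_gapSet_insert hi hs, ih, Finset.card_insert_of_notMem hi]
    congr 2
    push_cast
    ring

/-! ### Gap events with one point at the origin -/

theorem forwardGap_of_lt {u : ℝ} (h0 : 0 < u) (h1 : u ≤ 1) : forwardGap u = u := by
  simpa using forwardGap_eq (u := u) (m := 0) (by simpa using h0) (by simpa using h1)

theorem forwardGap_of_nonpos {u : ℝ} (h0 : -1 < u) (h1 : u ≤ 0) : forwardGap u = u + 1 := by
  simpa using forwardGap_eq (u := u) (m := 1) (by push_cast; linarith) (by push_cast; linarith)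

/-- The point at the origin, seen from `x i`, is the right end `1` of the box; it yields the
condition `x i + s < 1`. -/
theorem lt_forwardGap_succ_iff {N : ℕ} {x : Fin N → ℝ} (hx : ∀ j, 0 < x j ∧ x j < 1) {s : ℝ}
    (i : Fin N) :
    (∀ j : Fin (N + 1), s < forwardGap ((Fin.cons 0 x : Fin (N + 1) → ℝ) j - x i)) ↔
      x i + s < 1 ∧ ∀ j, x j ≤ x i ∨ x i + s < x j := by
  have hi := hx i
  rw [Fin.forall_fin_succ, Fin.cons_zero, forwardGap_of_nonpos (by linarith) (by linarith)]
  constructor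
  · rintro ⟨h0, h⟩
    refine ⟨by linarith, fun j => ?_⟩
    have hj := hx j
    have h := h j
    rw [Fin.cons_succ] at h
    rcases le_or_gt (x j) (x i) with hle | hlt
    · exact Or.inl hle
    · rw [forwardGap_of_lt (by linarith) (by linarith)] at h
      exact Or.inr (by linarith)
  · rintro ⟨h0, h⟩
    refine ⟨by linarith, fun j => ?_⟩
    have hj := hx j
    rw [Fin.cons_succ]
    rcases le_or_gt (x j) (x i) with hle | hlt
    · rw [forwardGap_of_nonpos (by linarith) (by linarith)]
      linarith
    · rw [forwardGap_of_lt (by linarith) (by linarith)]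
      linarith [(h j).resolve_left (not_le.2 hlt)]

/-- The hypothesis `s < 1` accounts for the origin's gap to itself, which is `1`. -/
theorem lt_forwardGap_zero_iff {N : ℕ} {x : Fin N → ℝ} (hx : ∀ j, 0 < x j ∧ x j < 1) {s : ℝ}
    (hs : s < 1) :
    (∀ j : Fin (N + 1), s < forwardGap ((Fin.cons 0 x : Fin (N + 1) → ℝ) j - 0)) ↔
      ∀ j, s < x j := by
  rw [Fin.forall_fin_succ, Fin.cons_zero, forwardGap_of_nonpos (by norm_num) (by norm_num)]
  simp only [Fin.cons_succ, sub_zero, zero_add, hs, true_and]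
  exact forall_congr' fun j => by rw [forwardGap_of_lt (hx j).1 (hx j).2.le]

/-- The configurations for which the point `i` is followed by a gap longer than `s`, where one
point is at the origin. -/
def gapEvent {N : ℕ} (s : ℝ) (i : Fin (N + 1)) : Set (Fin N → ℝ) :=
  {x | ∀ j, s < forwardGap
    ((Fin.cons 0 x : Fin (N + 1) → ℝ) j - (Fin.cons 0 x : Fin (N + 1) → ℝ) i)}

theorem measurable_forwardGap : Measurable forwardGap :=
  measurable_const.sub (measurable_fract.comp measurable_neg)

theorem measurable_cons_zero {N : ℕ} (i : Fin (N + 1)) :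
    Measurable fun x : Fin N → ℝ => (Fin.cons 0 x : Fin (N + 1) → ℝ) i := by
  refine Fin.cases ?_ (fun i => ?_) i
  · simp only [Fin.cons_zero]
    exact measurable_const
  · simp only [Fin.cons_succ]
    exact measurable_pi_apply i

theorem measurableSet_gapEvent {N : ℕ} (s : ℝ) (i : Fin (N + 1)) :
    MeasurableSet (gapEvent s i) := by
  rw [gapEvent, Set.ofPred_forall]
  exact MeasurableSet.iInter fun j => measurableSet_lt measurable_const
    (measurable_forwardGap.comp ((measurable_cons_zero j).sub (measurable_cons_zero i)))

theorem volume_iInter_gapEvent {N : ℕ} {s : ℝ} (hs0 : 0 ≤ s) (hs1 : s < 1)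
    {I : Finset (Fin (N + 1))} :
    volume ((⋂ i ∈ I, gapEvent s i) ∩ Set.pi Set.univ fun _ : Fin N => Set.Ioo (0 : ℝ) 1) =
      ENNReal.ofReal (1 - I.card * s) ^ N := by
  let I' : Finset (Fin N) := Finset.univ.filter fun i => i.succ ∈ I
  have hcard : I.card = (if (0 : Fin (N + 1)) ∈ I then 1 else 0) + I'.card := by
    rw [Finset.card_filter, ← Fin.sum_univ_succ fun i => if i ∈ I then 1 else 0]
    simp
  have hbox : ∀ x : Fin N → ℝ, (x ∈ Set.pi Set.univ fun _ : Fin N => Set.Ioo (0 : ℝ) 1) ↔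
      ∀ j, 0 < x j ∧ x j < 1 := fun x => by simp
  have hmem : ∀ x : Fin N → ℝ, (∀ j, 0 < x j ∧ x j < 1) → ((x ∈ ⋂ i ∈ I, gapEvent s i) ↔
      ((0 : Fin (N + 1)) ∈ I → ∀ j, s < x j) ∧
        ∀ i ∈ I', x i + s < 1 ∧ ∀ j, x j ≤ x i ∨ x i + s < x j) := by
    intro x hx
    simp only [Set.mem_iInter, I', Finset.mem_filter, Finset.mem_univ, true_and]
    rw [Fin.forall_fin_succ]
    refine and_congr (imp_congr_right fun _ => lt_forwardGap_zero_iff hx hs1)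
      (forall_congr' fun i => imp_congr_right fun _ => lt_forwardGap_succ_iff hx i)
  -- A gap after the origin is an empty initial interval of length `s`. Translating all points by
  -- `-s` removes it and shortens the box to `1 - s`.
  by_cases h0 : (0 : Fin (N + 1)) ∈ I
  · rw [if_pos h0] at hcard
    have : (⋂ i ∈ I, gapEvent s i) ∩ (Set.pi Set.univ fun _ : Fin N => Set.Ioo (0 : ℝ) 1) =
        (fun x => x + fun _ => -s) ⁻¹' gapSet I' (1 - s) s := by
      ext x
      rw [Set.mem_inter_iff, hbox, Set.mem_preimage]
      simp only [gapSet, Set.mem_ofPred_eq, Pi.add_apply]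
      constructor
      · rintro ⟨h, hx⟩
        obtain ⟨h1, h2⟩ := (hmem x hx).1 h
        refine ⟨fun j => ⟨by linarith [h1 h0 j], by linarith [(hx j).2]⟩, fun i hi => ?_⟩
        refine ⟨by linarith [(h2 i hi).1], fun j => ?_⟩
        exact ((h2 i hi).2 j).imp (fun h => by linarith) (fun h => by linarith)
      · rintro ⟨h1, h2⟩
        have hx : ∀ j, 0 < x j ∧ x j < 1 := fun j =>
          ⟨by linarith [(h1 j).1], by linarith [(h1 j).2]⟩
        refine ⟨(hmem x hx).2 ⟨fun _ j => by linarith [(h1 j).1], fun i hi => ?_⟩, hx⟩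
        refine ⟨by linarith [(h2 i hi).1], fun j => ?_⟩
        exact ((h2 i hi).2 j).imp (fun h => by linarith) (fun h => by linarith)
    rw [this, measure_preimage_add_right, volume_gapSet _ _ hs0, Fintype.card_fin, hcard]
    congr 2
    push_cast
    ring
  · rw [if_neg h0, zero_add] at hcard
    have : (⋂ i ∈ I, gapEvent s i) ∩ (Set.pi Set.univ fun _ : Fin N => Set.Ioo (0 : ℝ) 1) =
        gapSet I' 1 s := by
      ext x
      rw [Set.mem_inter_iff, hbox]
      constructor
      · rintro ⟨h, hx⟩
        exact ⟨hx, ((hmem x hx).1 h).2⟩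
      · rintro ⟨hx, h⟩
        exact ⟨(hmem x hx).2 ⟨fun h => absurd h h0, h⟩, hx⟩
    rw [this, volume_gapSet _ _ hs0, Fintype.card_fin, hcard]

/-- The tail of the largest gap between `N + 1` random points on the circle, one of which is at the
origin. -/
theorem measureReal_lt_maxGap {N : ℕ} {s : ℝ} (hs0 : 0 ≤ s) (hs1 : s < 1) :
    (volume.restrict (Set.pi Set.univ fun _ : Fin N => Set.Ioo (0 : ℝ) 1)).real
        {x | s < maxGap (Fin.cons 0 x : Fin (N + 1) → ℝ)} =
      ∑ k ∈ Finset.Icc 1 (N + 1), (-1 : ℝ) ^ (k - 1) * ((N + 1).choose k : ℝ) *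
        max (1 - k * s) 0 ^ N := by
  have hunion : {x : Fin N → ℝ | s < maxGap (Fin.cons 0 x : Fin (N + 1) → ℝ)} =
      ⋃ i ∈ (Finset.univ : Finset (Fin (N + 1))), gapEvent s i := by
    ext x
    simp [lt_maxGap_iff, gapEvent]
  have hfin : ∀ S : Set (Fin N → ℝ),
      (volume.restrict (Set.pi Set.univ fun _ : Fin N => Set.Ioo (0 : ℝ) 1)) S ≠ ⊤ := by
    intro S
    refine ne_top_of_le_ne_top ?_ (measure_mono (Set.subset_univ S))
    rw [Measure.restrict_apply_univ, Real.volume_pi_Ioo]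
    simp
  have hterm : ∀ I : Finset (Fin (N + 1)),
      (volume.restrict (Set.pi Set.univ fun _ : Fin N => Set.Ioo (0 : ℝ) 1)).real
        (⋂ i ∈ I, gapEvent s i) = max (1 - I.card * s) 0 ^ N := by
    intro I
    rw [measureReal_def, Measure.restrict_apply
      (Finset.measurableSet_biInter _ fun i _ => measurableSet_gapEvent s i),
      volume_iInter_gapEvent hs0 hs1, ENNReal.toReal_pow, ENNReal.toReal_ofReal']
  -- Inclusion-exclusion; each term depends only on the cardinality of `I`, so the subsets are then
  -- grouped by size.
  rw [hunion, measureReal_biUnion_eq_sum_powerset (fun i _ => measurableSet_gapEvent s i)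
    (fun i _ => hfin _)]
  simp only [hterm]
  rw [Finset.sum_filter]
  have hf : ∀ I ∈ (Finset.univ : Finset (Fin (N + 1))).powerset,
      (if I.Nonempty then (-1 : ℝ) ^ (I.card + 1) * max (1 - I.card * s) 0 ^ N else 0) =
      (fun k : ℕ => if 0 < k then (-1 : ℝ) ^ (k + 1) * max (1 - k * s) 0 ^ N else 0) I.card :=
    fun I _ => by simp only [Finset.card_pos]
  rw [Finset.sum_congr rfl hf, Finset.sum_powerset_apply_card fun k : ℕ =>
    if 0 < k then (-1 : ℝ) ^ (k + 1) * max (1 - k * s) 0 ^ N else 0, Finset.card_fin]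
  refine (Finset.sum_subset_zero_on_sdiff (fun k hk => ?_) (fun k hk => ?_) fun k hk => ?_).symm
  · rw [Finset.mem_range]
    have := (Finset.mem_Icc.1 hk).2
    omega
  · rw [Finset.mem_sdiff, Finset.mem_range, Finset.mem_Icc] at hk
    obtain rfl : k = 0 := by omega
    simp
  · obtain ⟨k, rfl⟩ : ∃ m, k = m + 1 := ⟨k - 1, by have := (Finset.mem_Icc.1 hk).1; omega⟩
    rw [if_pos k.succ_pos, nsmul_eq_mul, Nat.add_sub_cancel, pow_succ (-1 : ℝ) (k + 1),
      pow_succ (-1 : ℝ) k]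
    ring

open scoped Pointwise

/-! ## The law of the angle of a uniform point on the circle -/

theorem measurePreserving_toComplex :
    MeasurePreserving (fun y : EuclideanSpace ℝ (Fin 2) => (⟨y 0, y 1⟩ : ℂ)) := by
  have h := Complex.volume_preserving_equiv_pi.symm.comp (PiLp.volume_preserving_ofLp (Fin 2))
  convert h using 1
  ext y
  apply Complex.ext <;> simp [Complex.measurableEquivPi_symm_apply]

theorem measurable_turn : Measurable turn :=
  (Complex.measurable_arg.comp measurePreserving_toComplex.measurable).div_const _

theorem turn_smul {r : ℝ} (hr : 0 < r) (x : EuclideanSpace ℝ (Fin 2)) :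
    turn (r • x) = turn x := by
  have h : (⟨(r • x) 0, (r • x) 1⟩ : ℂ) = r * ⟨x 0, x 1⟩ := by
    apply Complex.ext <;> simp
  rw [turn, turn, h, Complex.arg_real_mul _ hr]

/-- The measure `toSphere` is defined by the volume of punctured cones, so arcs are measured through
sectors. -/
theorem Ioo_smul_turn_preimage (T : Set ℝ) :
    Set.Ioo (0 : ℝ) 1 • (Subtype.val ''
      {x : Metric.sphere (0 : EuclideanSpace ℝ (Fin 2)) 1 | turn x ∈ T}) =
      {y : EuclideanSpace ℝ (Fin 2) | 0 < ‖y‖ ∧ ‖y‖ < 1 ∧ turn y ∈ T} := by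
  ext y
  rw [Set.mem_smul]
  constructor
  · rintro ⟨r, hr, _, ⟨x, hx, rfl⟩, rfl⟩
    have hx1 : ‖(x : EuclideanSpace ℝ (Fin 2))‖ = 1 := by simp
    refine ⟨?_, ?_, ?_⟩
    · rw [norm_smul, hx1, mul_one, Real.norm_of_nonneg hr.1.le]; exact hr.1
    · rw [norm_smul, hx1, mul_one, Real.norm_of_nonneg hr.1.le]; exact hr.2
    · rw [turn_smul hr.1]; exact hx
  · rintro ⟨h0, h1, hT⟩
    refine ⟨‖y‖, ⟨h0, h1⟩, ‖y‖⁻¹ • y, ⟨⟨‖y‖⁻¹ • y, ?_⟩, ?_, rfl⟩, ?_⟩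
    · rw [mem_sphere_zero_iff_norm, norm_smul, norm_inv, norm_norm, inv_mul_cancel₀ h0.ne']
    · change turn (‖y‖⁻¹ • y) ∈ T
      rwa [turn_smul (inv_pos.2 h0)]
    · rw [smul_inv_smul₀ h0.ne']

theorem volume_sector {T : Set ℝ} (hT : MeasurableSet T) :
    volume {y : EuclideanSpace ℝ (Fin 2) | 0 < ‖y‖ ∧ ‖y‖ < 1 ∧ turn y ∈ T} =
      ENNReal.ofReal Real.pi * volume (T ∩ Set.Ioo (-(1 / 2)) (1 / 2)) := by
  classical
  have hpi := Real.pi_pos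
  let S : Set ℂ := {z | 0 < ‖z‖ ∧ ‖z‖ < 1 ∧ z.arg / (2 * Real.pi) ∈ T}
  have hS : MeasurableSet S :=
    (measurableSet_lt measurable_const measurable_norm).inter
      ((measurableSet_lt measurable_norm measurable_const).inter
        ((Complex.measurable_arg.div_const _) hT))
  have h1 : {y : EuclideanSpace ℝ (Fin 2) | 0 < ‖y‖ ∧ ‖y‖ < 1 ∧ turn y ∈ T} =
      (fun y : EuclideanSpace ℝ (Fin 2) => (⟨y 0, y 1⟩ : ℂ)) ⁻¹' S := by
    ext y
    simp only [S, Set.mem_preimage, Set.mem_ofPred_eq, norm_toComplex, turn]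
  rw [h1, measurePreserving_toComplex.measure_preimage hS.nullMeasurableSet,
    ← lintegral_indicator_one hS, ← Complex.lintegral_comp_polarCoord_symm]
  let A : Set ℝ := {θ | θ / (2 * Real.pi) ∈ T}
  have hA : MeasurableSet A := (measurable_id.div_const _) hT
  have h2 : ∀ p ∈ polarCoord.target, ENNReal.ofReal p.1 •
      S.indicator (1 : ℂ → ENNReal) (Complex.polarCoord.symm p) =
      (Set.Iio 1).indicator (fun r => ENNReal.ofReal r) p.1 * A.indicator 1 p.2 := by
    rintro ⟨r, θ⟩ hp
    have hr : 0 < r := hp.1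
    have hθ : θ ∈ Set.Ioc (-Real.pi) Real.pi := ⟨hp.2.1, hp.2.2.le⟩
    have harg : (Complex.polarCoord.symm (r, θ)).arg = θ := by
      rw [Complex.polarCoord_symm_apply]
      push_cast
      exact Complex.arg_mul_cos_add_sin_mul_I hr hθ
    have hnorm : ‖Complex.polarCoord.symm (r, θ)‖ = r := by
      rw [Complex.norm_polarCoord_symm, abs_of_pos hr]
    have hmem : Complex.polarCoord.symm (r, θ) ∈ S ↔ r < 1 ∧ θ ∈ A := by
      change (0 < ‖_‖ ∧ ‖_‖ < 1 ∧ Complex.arg _ / _ ∈ T) ↔ _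
      rw [harg, hnorm]
      simp [hr, A]
    rw [Set.indicator_apply, Set.indicator_apply, Set.indicator_apply]
    by_cases h1 : r < 1 <;> by_cases h2 : θ ∈ A <;> simp only [hmem, Set.mem_Iio, h1, h2] <;> simp
  rw [setLIntegral_congr_fun polarCoord.open_target.measurableSet h2, polarCoord_target,
    Measure.volume_eq_prod, ← Measure.prod_restrict, lintegral_prod_mul
      ((ENNReal.measurable_ofReal.indicator measurableSet_Iio).aemeasurable)
      ((measurable_one.indicator hA).aemeasurable), lintegral_indicator_one hA,
      lintegral_indicator measurableSet_Iio, Measure.restrict_restrict measurableSet_Iio,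
      Measure.restrict_apply hA]
  -- In polar coordinates the radial part contributes `1/2` and the rescaling of angles to turns
  -- `2π`; together they give the factor `π`.
  have h3 : ∫⁻ r in Set.Iio (1 : ℝ) ∩ Set.Ioi 0, ENNReal.ofReal r = ENNReal.ofReal (1 / 2) := by
    rw [← ofReal_integral_eq_lintegral_ofReal]
    · rw [Set.inter_comm, Set.Ioi_inter_Iio, ← integral_Ioc_eq_integral_Ioo,
        ← intervalIntegral.integral_of_le zero_le_one, integral_id]
      norm_num
    · rw [Set.inter_comm, Set.Ioi_inter_Iio]
      exact (continuous_id.integrableOn_Icc (a := 0) (b := 1)).mono_set Set.Ioo_subset_Icc_self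
    · exact (ae_restrict_mem (measurableSet_Iio.inter measurableSet_Ioi)).mono fun r hr => hr.2.le
  have h4 : T ∩ Set.Ioo (-(1 / 2)) (1 / 2) =
      (2 * Real.pi * ·) ⁻¹' (A ∩ Set.Ioo (-Real.pi) Real.pi) := by
    ext u
    simp only [A, Set.mem_inter_iff, Set.mem_preimage, Set.mem_ofPred_eq, Set.mem_Ioo]
    rw [mul_div_cancel_left₀ _ (by positivity)]
    refine and_congr_right fun _ => and_congr ?_ ?_ <;> constructor <;> intro h <;> nlinarith
  rw [h3, h4, Real.volume_preimage_mul_left (by positivity), ← mul_assoc,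
    ← ENNReal.ofReal_mul hpi.le, abs_of_pos (by positivity)]
  congr 2
  field_simp

theorem map_turn_toSphere {T : Set ℝ} (hT : MeasurableSet T) :
    (volume : Measure (EuclideanSpace ℝ (Fin 2))).toSphere {x | turn x ∈ T} =
      ENNReal.ofReal (2 * Real.pi) * volume (T ∩ Set.Ioo (-(1 / 2)) (1 / 2)) := by
  have hm : MeasurableSet {x : Metric.sphere (0 : EuclideanSpace ℝ (Fin 2)) 1 | turn x ∈ T} :=
    (measurable_turn.comp measurable_subtype_coe) hT
  rw [Measure.toSphere_apply' _ hm,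
    Ioo_smul_turn_preimage, volume_sector hT, ← mul_assoc, ENNReal.ofReal_mul zero_le_two]
  simp

/-- The angle of a uniform point on the circle is uniform. -/
theorem map_turn_of_isUniform {Ω : Type*} [MeasurableSpace Ω] {ℙ : Measure Ω}
    {X : Ω → Metric.sphere (0 : EuclideanSpace ℝ (Fin 2)) 1} (hX : Measurable X)
    (hunif : pdf.IsUniform X Set.univ ℙ
      (volume : Measure (EuclideanSpace ℝ (Fin 2))).toSphere) :
    Measure.map (fun ω => turn (X ω)) ℙ = volume.restrict (Set.Ioo (-(1 / 2) : ℝ) (1 / 2)) := by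
  have hm : Measurable fun x : Metric.sphere (0 : EuclideanSpace ℝ (Fin 2)) 1 => turn x :=
    measurable_turn.comp measurable_subtype_coe
  have huniv : (volume : Measure (EuclideanSpace ℝ (Fin 2))).toSphere Set.univ =
      ENNReal.ofReal (2 * Real.pi) := by
    have := map_turn_toSphere MeasurableSet.univ
    simp only [Set.mem_univ, Set.univ_inter, Real.volume_Ioo] at this
    rw [Set.ofPred_true] at this
    rw [this]
    norm_num
  ext T hT
  rw [← Function.comp_def (fun x : Metric.sphere (0 : EuclideanSpace ℝ (Fin 2)) 1 => turn x) X,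
    ← Measure.map_map hm hX, hunif, Measure.map_apply hm hT, Measure.restrict_apply hT,
    ProbabilityTheory.cond_apply MeasurableSet.univ, Set.univ_inter, huniv]
  refine (congrArg _ (map_turn_toSphere hT)).trans ?_
  rw [ ← mul_assoc, ENNReal.inv_mul_cancel (by simp [Real.pi_pos]) ENNReal.ofReal_ne_top, one_mul]

/-! ## The expectation -/

/-- `Int.fract` factors through the circle `ℝ/ℤ`, on which every interval of length one induces the
same measure; on `(0, 1)` it is the identity. -/
theorem map_fract_restrict_Ioc (t : ℝ) :
    Measure.map Int.fract (volume.restrict (Set.Ioc t (t + 1))) =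
      volume.restrict (Set.Ioo (0 : ℝ) 1) := by
  let F : AddCircle (1 : ℝ) → ℝ := fun c => (AddCircle.equivIco 1 0 c : ℝ)
  have hF : Measurable F :=
    measurable_subtype_coe.comp (AddCircle.measurableEquivIco (1 : ℝ) 0).measurable
  have hFmk : (fun x : ℝ => F (x : AddCircle (1 : ℝ))) = Int.fract := by
    ext x
    exact (AddCircle.coe_equivIco_mk_apply 1 x).trans (by simp)
  have hmk : ∀ t : ℝ, Measure.map Int.fract (volume.restrict (Set.Ioc t (t + 1))) =
      Measure.map F volume := by
    intro t
    have h := AddCircle.measurePreserving_mk (1 : ℝ) t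
    rw [← h.map_eq, Measure.map_map hF h.measurable, ← hFmk]
    rfl
  have h0 : Measure.map Int.fract (volume.restrict (Set.Ioo (0 : ℝ) 1)) =
      volume.restrict (Set.Ioo (0 : ℝ) 1) := by
    conv_rhs => rw [← Measure.map_id (μ := volume.restrict (Set.Ioo (0 : ℝ) 1))]
    refine Measure.map_congr ((ae_restrict_mem measurableSet_Ioo).mono fun x hx => ?_)
    exact Int.fract_eq_self.2 ⟨hx.1.le, hx.2⟩
  rw [hmk t, ← hmk 0, zero_add, ← restrict_Ioo_eq_restrict_Ioc, h0]

theorem map_fract_sub (a : ℝ) :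
    Measure.map (fun x => Int.fract (x - a)) (volume.restrict (Set.Ioo (-(1 / 2) : ℝ) (1 / 2))) =
      volume.restrict (Set.Ioo (0 : ℝ) 1) := by
  have h1 : Measure.map (fun x => x - a) (volume.restrict (Set.Ioo (-(1 / 2) : ℝ) (1 / 2))) =
      volume.restrict (Set.Ioc (-(1 / 2) - a) (-(1 / 2) - a + 1)) := by
    have h := (measurePreserving_sub_right volume a).restrict_preimage
      (measurableSet_Ioc (a := -(1 / 2) - a) (b := -(1 / 2) - a + 1))
    rw [← h.map_eq, Set.preimage_sub_const_Ioc, restrict_Ioo_eq_restrict_Ioc]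
    congr 3 <;> ring
  rw [← map_fract_restrict_Ioc (-(1 / 2) - a), ← h1,
    Measure.map_map measurable_fract (measurable_sub_const a)]
  rfl

/-- Relative to the first one, the remaining independent uniform points on the circle are again
independent and uniform. -/
theorem map_fract_sub_pi (N : ℕ) :
    Measure.map (fun (θ : Fin (N + 1) → ℝ) (j : Fin N) => Int.fract (θ j.succ - θ 0))
        (Measure.pi fun _ => volume.restrict (Set.Ioo (-(1 / 2) : ℝ) (1 / 2))) =
      volume.restrict (Set.pi Set.univ fun _ : Fin N => Set.Ioo (0 : ℝ) 1) := by
  have hU : IsProbabilityMeasure (volume.restrict (Set.Ioo (-(1 / 2) : ℝ) (1 / 2))) :=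
    ⟨by rw [Measure.restrict_apply_univ, Real.volume_Ioo]; norm_num⟩
  have h1 := measurePreserving_piFinSuccAbove
    (fun _ : Fin (N + 1) => volume.restrict (Set.Ioo (-(1 / 2) : ℝ) (1 / 2))) 0
  -- For each fixed value `a` of the first coordinate, the differences modulo one are independent
  -- and uniform, with a law that does not depend on `a`.
  have h2 := (MeasurePreserving.id
    (volume.restrict (Set.Ioo (-(1 / 2) : ℝ) (1 / 2)))).skew_product
    (μc := Measure.pi fun _ : Fin N => volume.restrict (Set.Ioo (-(1 / 2) : ℝ) (1 / 2)))
    (μd := Measure.pi fun _ : Fin N => volume.restrict (Set.Ioo (0 : ℝ) 1))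
    (g := fun a c j => Int.fract (c j - a)) (by
      refine measurable_pi_iff.2 fun j => measurable_fract.comp ?_
      exact ((measurable_pi_apply j).comp measurable_snd).sub measurable_fst)
    (Filter.Eventually.of_forall fun a => by
      have hm : Measurable fun x : ℝ => Int.fract (x - a) :=
        measurable_fract.comp (measurable_sub_const a)
      rw [Measure.pi_map_pi (f := fun _ x => Int.fract (x - a)) fun j => hm.aemeasurable]
      exact congrArg Measure.pi (funext fun j => map_fract_sub a))
  have h3 := (measurePreserving_snd (μ := volume.restrict (Set.Ioo (-(1 / 2) : ℝ) (1 / 2)))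
    (ν := Measure.pi fun _ : Fin N => volume.restrict (Set.Ioo (0 : ℝ) 1))).comp (h2.comp h1)
  rw [volume_pi, Measure.restrict_pi_pi, ← h3.map_eq]
  rfl

/-- Gaps depend only on differences modulo one, so the first point may be rotated to the origin. -/
theorem maxGap_eq_maxGap_cons {N : ℕ} (θ : Fin (N + 1) → ℝ) :
    maxGap θ = maxGap (Fin.cons 0 fun j : Fin N => Int.fract (θ j.succ - θ 0) :
      Fin (N + 1) → ℝ) := by
  have h : ∀ i : Fin (N + 1), ∃ m : ℤ, (Fin.cons 0 fun j : Fin N => Int.fract (θ j.succ - θ 0) :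
      Fin (N + 1) → ℝ) i = θ i - θ 0 + m := by
    refine Fin.cases ⟨0, by simp⟩ fun j => ⟨-⌊θ j.succ - θ 0⌋, ?_⟩
    rw [Fin.cons_succ, Int.fract]
    push_cast
    ring
  choose m hm using h
  unfold maxGap
  congr with i
  congr with j
  rw [hm, hm, ← forwardGap_add_int (θ j - θ i) (m j - m i)]
  congr 1
  push_cast
  ring

theorem measurable_maxGap {N : ℕ} :
    Measurable fun x : Fin N → ℝ => maxGap (Fin.cons 0 x : Fin (N + 1) → ℝ) :=
  Measurable.iSup fun i => Measurable.iInf fun j =>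
    measurable_forwardGap.comp ((measurable_cons_zero j).sub (measurable_cons_zero i))

/-- The layer-cake form of the sine, which brings in the tail `{t < g}` of the largest gap. -/
theorem sin_min_eq_integral {g : ℝ} (hg : 0 ≤ g) :
    Real.sin (Real.pi * min g (1 / 2)) = ∫ t in Set.Ioc (0 : ℝ) (1 / 2),
      {t | t < g}.indicator (fun t => Real.pi * Real.cos (Real.pi * t)) t := by
  have h0 : 0 ≤ min g (1 / 2) := le_min hg (by norm_num)
  have h1 : ∫ t in (0 : ℝ)..min g (1 / 2), Real.pi * Real.cos (Real.pi * t) =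
      Real.sin (Real.pi * min g (1 / 2)) := by
    rw [intervalIntegral.integral_const_mul,
      intervalIntegral.mul_integral_comp_mul_left (f := Real.cos)]
    simp
  have hg' : MeasurableSet {t : ℝ | t < g} := measurableSet_Iio
  rw [integral_indicator hg', Measure.restrict_restrict hg', ← h1,
    intervalIntegral.integral_of_le h0]
  rcases le_or_gt g (1 / 2) with h | h
  · rw [min_eq_left h, integral_Ioc_eq_integral_Ioo]
    congr 2
    ext t
    simp only [Set.mem_Ioo, Set.mem_inter_iff, Set.mem_Ioc, Set.mem_ofPred_eq]
    constructor
    · rintro ⟨a, b⟩; exact ⟨b, a, by linarith⟩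
    · rintro ⟨a, b, -⟩; exact ⟨b, a⟩
  · rw [min_eq_right h.le]
    congr 2
    ext t
    simp only [Set.mem_inter_iff, Set.mem_Ioc, Set.mem_ofPred_eq]
    exact ⟨fun ht => ⟨by linarith [ht.2], ht⟩, fun ht => ht.2⟩

theorem integral_max_pow {N k : ℕ} (hk : 1 ≤ k) (hkN : k ≤ N + 1) :
    ∫ t in (0 : ℝ)..1 / 2, Real.pi * Real.cos (Real.pi * t) * max (1 - k * t) 0 ^ N =
      ∫ t in (0 : ℝ)..min (1 / 2) (1 / (k : ℝ)),
        Real.pi * Real.cos (Real.pi * t) * (1 - (k : ℝ) * t) ^ N := by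
  have hk0 : (0 : ℝ) < k := by exact_mod_cast hk
  have hm0 : 0 ≤ min (1 / 2) (1 / (k : ℝ)) := le_min (by norm_num) (by positivity)
  have hcont : Continuous fun t : ℝ =>
      Real.pi * Real.cos (Real.pi * t) * max (1 - k * t) 0 ^ N := by fun_prop
  rw [← intervalIntegral.integral_add_adjacent_intervals
    (hcont.intervalIntegrable 0 (min (1 / 2) (1 / (k : ℝ))))
    (hcont.intervalIntegrable (min (1 / 2) (1 / (k : ℝ))) (1 / 2))]
  have h2 : ∫ t in min (1 / 2) (1 / (k : ℝ))..1 / 2,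
      Real.pi * Real.cos (Real.pi * t) * max (1 - k * t) 0 ^ N = 0 := by
    rcases le_or_gt (1 / 2 : ℝ) (1 / k) with h | h
    · rw [min_eq_left h, intervalIntegral.integral_same]
    · rw [min_eq_right h.le]
      have hk2 : (2 : ℝ) < k := by
        rw [div_lt_div_iff₀ hk0 two_pos] at h
        linarith
      have hk2' : 2 < k := by exact_mod_cast hk2
      -- The truncated factor vanishes beyond `1/k` only for a positive exponent, since `0 ^ 0 = 1`.
      -- A tail beyond `1/k` exists only if `k > 2`, which forces `N ≥ 2`.
      have hN : N ≠ 0 := by omega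
      rw [intervalIntegral.integral_congr (g := fun _ => 0)]
      · simp
      · intro t ht
        rw [Set.uIcc_of_le h.le] at ht
        have : 1 - k * t ≤ 0 := by
          have := (div_le_iff₀ hk0).1 ht.1
          linarith
        simp [max_eq_right this, hN]
  rw [h2, add_zero]
  refine intervalIntegral.integral_congr fun t ht => ?_
  rw [Set.uIcc_of_le hm0] at ht
  have : 0 ≤ 1 - k * t := by
    have := (le_div_iff₀ hk0).1 (ht.2.trans (min_le_right _ _))
    linarith
  simp only [max_eq_left this]

theorem integral_sin_maxGap (N : ℕ) :
    ∫ x, Real.sin (Real.pi * min (maxGap (Fin.cons 0 x : Fin (N + 1) → ℝ)) (1 / 2))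
        ∂(volume.restrict (Set.pi Set.univ fun _ : Fin N => Set.Ioo (0 : ℝ) 1)) =
      ∑ k ∈ Finset.Icc 1 (N + 1), (-1 : ℝ) ^ (k - 1) * ((N + 1).choose k : ℝ) *
        ∫ t in (0 : ℝ)..min (1 / 2) (1 / (k : ℝ)),
          Real.pi * Real.cos (Real.pi * t) * (1 - (k : ℝ) * t) ^ N := by
  set ν := volume.restrict (Set.pi Set.univ fun _ : Fin N => Set.Ioo (0 : ℝ) 1) with hν
  have hfin : IsFiniteMeasure ν := ⟨by
    rw [hν, Measure.restrict_apply_univ, Real.volume_pi_Ioo]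
    simp⟩
  let f : (Fin N → ℝ) → ℝ → ℝ := fun x t =>
    {t | t < maxGap (Fin.cons 0 x : Fin (N + 1) → ℝ)}.indicator
      (fun t => Real.pi * Real.cos (Real.pi * t)) t
  have hS : MeasurableSet {p : (Fin N → ℝ) × ℝ |
      p.2 < maxGap (Fin.cons 0 p.1 : Fin (N + 1) → ℝ)} :=
    measurableSet_lt measurable_snd (measurable_maxGap.comp measurable_fst)
  have hcos : Measurable fun p : (Fin N → ℝ) × ℝ => Real.pi * Real.cos (Real.pi * p.2) := by
    fun_prop
  have hf : Integrable (Function.uncurry f)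
      (ν.prod (volume.restrict (Set.Ioc (0 : ℝ) (1 / 2)))) := by
    refine Integrable.of_bound (C := Real.pi) (hcos.indicator hS).aestronglyMeasurable
      (Filter.Eventually.of_forall fun p => ?_)
    refine (norm_indicator_le_norm_self
      (fun t => Real.pi * Real.cos (Real.pi * t)) p.2).trans ?_
    rw [norm_mul, Real.norm_of_nonneg Real.pi_pos.le]
    exact mul_le_of_le_one_right Real.pi_pos.le (Real.abs_cos_le_one _)
  have h1 : ∀ x : Fin N → ℝ,
      Real.sin (Real.pi * min (maxGap (Fin.cons 0 x : Fin (N + 1) → ℝ)) (1 / 2)) =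
      ∫ t in Set.Ioc (0 : ℝ) (1 / 2), f x t := fun x => sin_min_eq_integral (maxGap_pos _).le
  have h2 : ∀ t ∈ Set.Ioc (0 : ℝ) (1 / 2), ∫ x, f x t ∂ν =
      ∑ k ∈ Finset.Icc 1 (N + 1), (-1 : ℝ) ^ (k - 1) * ((N + 1).choose k : ℝ) *
        (Real.pi * Real.cos (Real.pi * t) * max (1 - k * t) 0 ^ N) := by
    intro t ht
    have hmeas : MeasurableSet {x : Fin N → ℝ | t < maxGap (Fin.cons 0 x : Fin (N + 1) → ℝ)} :=
      measurableSet_lt measurable_const measurable_maxGap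
    have h3 : ∀ x, f x t = {x : Fin N → ℝ |
        t < maxGap (Fin.cons 0 x : Fin (N + 1) → ℝ)}.indicator
          (fun _ => Real.pi * Real.cos (Real.pi * t)) x := fun x => rfl
    simp only [h3]
    rw [integral_indicator_const _ hmeas, hν,
      measureReal_lt_maxGap ht.1.le (by linarith [ht.2]), smul_eq_mul, Finset.sum_mul]
    refine Finset.sum_congr rfl fun k _ => ?_
    ring
  simp only [h1]
  rw [integral_integral_swap hf, setIntegral_congr_fun measurableSet_Ioc h2,
    ← intervalIntegral.integral_of_le (by norm_num), intervalIntegral.integral_finsetSum]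
  · refine Finset.sum_congr rfl fun k hk => ?_
    rw [intervalIntegral.integral_const_mul, integral_max_pow (Finset.mem_Icc.1 hk).1
      (Finset.mem_Icc.1 hk).2]
  · intro k _
    exact Continuous.intervalIntegrable (by fun_prop) _ _

theorem mainTheorem8 {𝕜 : Type*} [Field 𝕜] {Ω : Type*} [MeasurableSpace Ω]
    (ℙ : MeasureTheory.Measure Ω) [MeasureTheory.IsProbabilityMeasure ℙ]
    (n : ℕ) (hn : 1 ≤ n)
    (X : Fin n → Ω → Metric.sphere (0 : EuclideanSpace ℝ (Fin 2)) 1)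
    (hX : ∀ i, Measurable (X i))
    (hindep : ProbabilityTheory.iIndepFun X ℙ)
    (hunif : ∀ i, MeasureTheory.pdf.IsUniform (X i) Set.univ ℙ
      (MeasureTheory.volume : MeasureTheory.Measure (EuclideanSpace ℝ (Fin 2))).toSphere) :
    (∀ ω, (∃! B, IsBarcode (persistentHomology 𝕜 1
          (Set.range fun i => (X i ω : EuclideanSpace ℝ (Fin 2)))) B) ∧
        (barcode (persistentHomology 𝕜 1
          (Set.range fun i => (X i ω : EuclideanSpace ℝ (Fin 2))))).card ≤ 1) ∧
      MeasureTheory.Integrable (fun ω => barcodeLength (barcode (persistentHomology 𝕜 1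
          (Set.range fun i => (X i ω : EuclideanSpace ℝ (Fin 2)))))) ℙ ∧
      ∫ ω, barcodeLength (barcode (persistentHomology 𝕜 1
          (Set.range fun i => (X i ω : EuclideanSpace ℝ (Fin 2))))) ∂ℙ =
        1 - ∑ k ∈ Finset.Icc 1 n, (-1 : ℝ) ^ (k - 1) * (n.choose k : ℝ) *
          ∫ t in (0 : ℝ)..min (1 / 2) (1 / (k : ℝ)),
            Real.pi * Real.cos (Real.pi * t) * (1 - (k : ℝ) * t) ^ (n - 1) := by
  obtain ⟨N, rfl⟩ : ∃ N, n = N + 1 := ⟨n - 1, by omega⟩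
  rw [Nat.add_sub_cancel]
  have hbar := fun ω => exists_barcode_circle 𝕜
    (p := fun i => (X i ω : EuclideanSpace ℝ (Fin 2))) fun i => by simp
  let Ψ : Ω → Fin N → ℝ := fun ω j => Int.fract (turn (X j.succ ω) - turn (X 0 ω))
  let H : (Fin N → ℝ) → ℝ := fun x =>
    Real.sin (Real.pi * min (maxGap (Fin.cons 0 x : Fin (N + 1) → ℝ)) (1 / 2))
  -- Uniqueness makes the chosen barcode equal to the computed one. The length is thus a measurable
  -- function of the angles relative to the first point.
  have hlen : ∀ ω, barcodeLength (barcode (persistentHomology 𝕜 1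
      (Set.range fun i => (X i ω : EuclideanSpace ℝ (Fin 2))))) = 1 - H (Ψ ω) := by
    intro ω
    obtain ⟨B, hB, huniq, -, hB4⟩ := hbar ω
    rw [barcode_eq hB huniq, hB4, maxGap_eq_maxGap_cons]
  have hθ : ∀ i, Measurable fun ω => turn (X i ω) := fun i =>
    measurable_turn.comp (measurable_subtype_coe.comp (hX i))
  have hrot : Measurable fun (θ : Fin (N + 1) → ℝ) (j : Fin N) => Int.fract (θ j.succ - θ 0) :=
    measurable_pi_iff.2 fun j => measurable_fract.comp
      ((measurable_pi_apply j.succ).sub (measurable_pi_apply 0))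
  have hΨ : Measurable Ψ := hrot.comp (measurable_pi_iff.2 hθ)
  have hH : Measurable H := by
    exact Real.measurable_sin.comp ((measurable_maxGap.min measurable_const).const_mul _)
  have hlaw : Measure.map Ψ ℙ =
      volume.restrict (Set.pi Set.univ fun _ : Fin N => Set.Ioo (0 : ℝ) 1) := by
    have hind : ProbabilityTheory.iIndepFun (fun i ω => turn (X i ω)) ℙ :=
      hindep.comp (fun _ x => turn x) fun _ => measurable_turn.comp measurable_subtype_coe
    have hjoint := (ProbabilityTheory.iIndepFun_iff_map_fun_eq_pi_map
      fun i => (hθ i).aemeasurable).1 hind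
    simp only [fun i => map_turn_of_isUniform (hX i) (hunif i)] at hjoint
    rw [← map_fract_sub_pi, ← hjoint, Measure.map_map hrot (measurable_pi_iff.2 hθ)]
    rfl
  have hint : Integrable (fun ω => H (Ψ ω)) ℙ :=
    Integrable.of_bound (C := 1) (hH.comp hΨ).aestronglyMeasurable
      (Filter.Eventually.of_forall fun ω => Real.abs_sin_le_one _)
  refine ⟨fun ω => ?_, ?_, ?_⟩
  · obtain ⟨B, hB, huniq, hcard, -⟩ := hbar ω
    exact ⟨⟨B, hB, huniq⟩, by rwa [barcode_eq hB huniq]⟩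
  · simp only [hlen]
    exact (integrable_const 1).sub hint
  · simp only [hlen]
    rw [integral_sub (integrable_const 1) hint, ← integral_map (f := H) hΨ.aemeasurable
      hH.aestronglyMeasurable, hlaw, integral_sin_maxGap]
    simp
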